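/- **Kirwan–Ness inequality.** Let $(X,\omega,J)$ be a closed Kähler manifold: $X$ is a compact complex manifold (without boundary) with complex structure $J$, and $\omega$ is a smooth closed $2$-form such that $\langle\cdot,\cdot\rangle:=\omega(\cdot,J\cdot)$ is a Riemannian metric. Let $\mathrm G\subset\mathrm U(n)$ be a compact Lie group with Lie algebra $\mathfrak g\subset\mathfrak u(n)$, equipped with an inner product $\langle\cdot,\cdot\rangle$ that is invariant under $\xi\mapsto u\xi u^{-1}$ for $u\in\mathrm G$, and write $|\xi|=\langle\xi,\xi\rangle^{1/2}$. Let $\mathrm G$ act smoothly on $X$ by Kähler isometries (preserving $\omega$ and $J$), and for $\xi\in\mathfrak g$ let $v_\xi(x)=\frac{d}{dt}\big|_{t=0}\exp(t\xi)x$ be the infinitesimal action. Let $\mu:X\to\mathfrak g$ be an equivariant moment map, i.e. a smooth map such that $$\langle d\mu(x)\hat x,\xi\rangle=\omega(v_\xi(x),\hat x),\qquad \mu(ux)=u\mu(x)u^{-1}$$ for all $x\in X$, $\hat x\in T_xX$, $\xi\in\mathfrak g$, $u\in\mathrm G$. Let $$\mathrm G^c=\{\exp(\mathrm i\eta)u \mid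 u\in\mathrm G,\ \eta\in\mathfrak g\}\subset\mathrm{GL}(n,\mathbb C)$$ be the complexification of $\mathrm G$, which is a closed subgroup of $\mathrm{GL}(n,\mathbb C)$, and let it act on $X$ by the holomorphic action $\mathrm G^c\times X\to X$ that extends the action of $\mathrm G$. If $x\in X$ is a critical point of the moment map squared $f=\tfrac12|\mu|^2:X\to\mathbb R$, then $$|\mu(x)|\le|\mu(gx)|\qquad\text{for all } g\in\mathrm G^c.$$ -/

import Mathlib

open Set Filter Topology
open scoped Manifold ContDiff Matrix

noncomputable section

namespace KirwanNess

/-- Complex `n × n` matrices. -/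
abbrev Mat (n : ℕ) : Type := Matrix (Fin n) (Fin n) ℂ

/-- The matrix exponential as a map into `GL(n, ℂ)`. -/
def expGL {n : ℕ} (A : Mat n) : GL (Fin n) ℂ := (Matrix.isUnit_exp A).unit

@[simp] theorem coe_expGL {n : ℕ} (A : Mat n) : ((expGL A : GL (Fin n) ℂ) : Mat n) =
    NormedSpace.exp A := rfl

/-- A compact Lie group `G ⊂ U(n)`: a compact subgroup of `GL(n, ℂ)` consisting of unitary
matrices. -/
structure CompactUnitaryGroup (n : ℕ) where
  /-- the underlying group -/
  grp : Subgroup (GL (Fin n) ℂ)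
  unitary : ∀ g ∈ grp, (g : Mat n) ∈ Matrix.unitaryGroup (Fin n) ℂ
  compact : IsCompact (grp : Set (GL (Fin n) ℂ))

section LieProduct

variable {R : Type*} [NormedRing R]

theorem norm_pow_sub_pow_mul_le (x y : R) (C M : ℝ) (hC : 0 ≤ C) (k : ℕ)
    (hx : ∀ j ≤ k, ‖x ^ j‖ ≤ C) (hy : ∀ j ≤ k, ‖y ^ j‖ ≤ M) :
    ∀ m i : ℕ, m + i ≤ k → ‖(x ^ m - y ^ m) * y ^ i‖ ≤ m * (C * ‖x - y‖ * M) := by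
  intro m
  induction m with
  | zero => intro i _; simp
  | succ m ih =>
    intro i hi
    have h1 : (x ^ (m + 1) - y ^ (m + 1)) * y ^ i
        = x ^ m * (x - y) * y ^ i + (x ^ m - y ^ m) * y ^ (i + 1) := by
      rw [pow_succ, pow_succ, pow_succ']
      noncomm_ring
    have h2 := ih (i + 1) (by omega)
    have h3 : ‖x ^ m * (x - y) * y ^ i‖ ≤ C * ‖x - y‖ * M := by
      refine (norm_mul_le _ _).trans ?_
      refine mul_le_mul ?_ (hy i (by omega)) (norm_nonneg _) (by positivity)
      exact (norm_mul_le _ _).trans (by gcongr; exact hx m (by omega))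
    rw [h1]
    refine (norm_add_le _ _).trans ?_
    push_cast
    linarith

variable [NormedAlgebra ℝ R] [NormedAlgebra ℚ R] [CompleteSpace R]

/-- The Lie product formula, along a sequence whose powers stay bounded. -/
theorem lie_product (a b : R) (C : ℝ)
    (hC : ∀ k j : ℕ, ‖(NormedSpace.exp ((k : ℝ)⁻¹ • a) *
      NormedSpace.exp ((k : ℝ)⁻¹ • b)) ^ j‖ ≤ C) :
    Tendsto (fun k : ℕ => (NormedSpace.exp ((k : ℝ)⁻¹ • a) *
      NormedSpace.exp ((k : ℝ)⁻¹ • b)) ^ k) atTop (𝓝 (NormedSpace.exp (a + b))) := by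
  have hC0 : 0 ≤ C := (norm_nonneg _).trans (hC 0 0)
  obtain ⟨M, hM⟩ : ∃ M, ∀ s ∈ Icc (0 : ℝ) 1, ‖NormedSpace.exp (s • (a + b))‖ ≤ M := by
    have hc : Continuous fun s : ℝ => NormedSpace.exp (s • (a + b)) :=
      NormedSpace.exp_continuous.comp (by fun_prop)
    exact isCompact_Icc.exists_bound_of_continuousOn hc.continuousOn
  let φ : ℝ → R := fun s => NormedSpace.exp (s • a) * NormedSpace.exp (s • b) -
    NormedSpace.exp (s • (a + b))
  have hφ : HasDerivAt φ 0 0 := by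
    have h := ((hasDerivAt_exp_smul_const (𝕂 := ℝ) a 0).mul
      (hasDerivAt_exp_smul_const (𝕂 := ℝ) b 0)).sub
      (hasDerivAt_exp_smul_const (𝕂 := ℝ) (a + b) 0)
    rw [zero_smul, zero_smul, zero_smul, NormedSpace.exp_zero, mul_one, one_mul, one_mul,
      one_mul, one_mul, sub_self] at h
    exact h
  have hlim : Tendsto (fun k : ℕ => (k : ℝ) * ‖φ ((k : ℝ)⁻¹)‖) atTop (𝓝 0) := by
    have h1 := hφ.isLittleO
    have h2 : φ 0 = 0 := by simp [φ]
    have h3 : φ =o[𝓝 0] fun s : ℝ => s := by simpa [h2] using h1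
    have h4 := h3.comp_tendsto (tendsto_inv_atTop_nhds_zero_nat (𝕜 := ℝ))
    have h5 := h4.norm_left.tendsto_div_nhds_zero
    refine h5.congr fun k => ?_
    simp [div_eq_mul_inv, mul_comm]
  rw [tendsto_iff_norm_sub_tendsto_zero]
  have hlim2 : Tendsto (fun k : ℕ => (C * M) * ((k : ℝ) * ‖φ ((k : ℝ)⁻¹)‖)) atTop (𝓝 0) := by
    simpa using hlim.const_mul (C * M)
  refine squeeze_zero' (Eventually.of_forall fun _ => norm_nonneg _) ?_ hlim2
  filter_upwards [eventually_gt_atTop 0] with k hk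
  have hk' : (0 : ℝ) < k := by exact_mod_cast hk
  have hpow : ∀ j : ℕ, NormedSpace.exp ((k : ℝ)⁻¹ • (a + b)) ^ j
      = NormedSpace.exp (((j : ℝ) * (k : ℝ)⁻¹) • (a + b)) := by
    intro j
    rw [← NormedSpace.exp_nsmul, mul_smul, Nat.cast_smul_eq_nsmul]
  have hy : ∀ j ≤ k, ‖NormedSpace.exp ((k : ℝ)⁻¹ • (a + b)) ^ j‖ ≤ M := by
    intro j hj
    rw [hpow]
    refine hM _ ⟨by positivity, ?_⟩
    rw [← div_eq_mul_inv, div_le_one hk']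
    exact_mod_cast hj
  have h := norm_pow_sub_pow_mul_le _ _ C M hC0 k (fun j _ => hC k j) hy k 0 (by omega)
  have hkk : NormedSpace.exp ((k : ℝ)⁻¹ • (a + b)) ^ k = NormedSpace.exp (a + b) := by
    rw [hpow, mul_inv_cancel₀ hk'.ne', one_smul]
  rw [pow_zero, mul_one, hkk] at h
  refine h.trans (le_of_eq ?_)
  simp only [φ]
  ring

end LieProduct

namespace CompactUnitaryGroup

variable {n : ℕ} (G : CompactUnitaryGroup n)

open scoped Matrix.Norms.Operator in
theorem exp_add_mem (A B : Mat n) (hA : ∀ t : ℝ, expGL (t • A) ∈ G.grp)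
    (hB : ∀ t : ℝ, expGL (t • B) ∈ G.grp) : expGL (A + B) ∈ G.grp := by
  let _ : NormedAlgebra ℚ (Mat n) := NormedAlgebra.restrictScalars ℚ ℝ (Mat n)
  have hcpt : IsCompact ((fun g : GL (Fin n) ℂ => (g : Mat n)) '' (G.grp : Set (GL (Fin n) ℂ))) :=
    G.compact.image Units.continuous_val
  obtain ⟨C, hC⟩ := hcpt.isBounded.exists_norm_le
  have hmem : ∀ k j : ℕ, (expGL ((k : ℝ)⁻¹ • A) * expGL ((k : ℝ)⁻¹ • B)) ^ j ∈ G.grp :=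
    fun k j => G.grp.pow_mem (G.grp.mul_mem (hA _) (hB _)) j
  have hlim := lie_product A B C fun k j => hC _ ⟨_, hmem k j, rfl⟩
  obtain ⟨g, hg, hgE⟩ := hcpt.isClosed.mem_of_tendsto hlim
    (Eventually.of_forall fun k => ⟨_, hmem k k, rfl⟩)
  have : expGL (A + B) = g := Units.ext hgE.symm
  rw [this]
  exact hg

/-- The Lie algebra `𝔤 = {ξ | exp (t ξ) ∈ G for all real t}` of `G ⊂ U(n)`. -/
def lie : Submodule ℝ (Mat n) where
  carrier := {ξ | ∀ t : ℝ, expGL (t • ξ) ∈ G.grp}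
  add_mem' := by
    intro A B hA hB t
    rw [smul_add]
    refine G.exp_add_mem _ _ (fun s => ?_) (fun s => ?_)
    · rw [smul_smul]; exact hA _
    · rw [smul_smul]; exact hB _
  zero_mem' := by
    intro t
    have : expGL (t • (0 : Mat n)) = 1 := Units.ext (by simp)
    rw [this]
    exact G.grp.one_mem
  smul_mem' := by
    intro c A hA t
    rw [smul_smul]
    exact hA _

/-- The adjoint action `ξ ↦ u ξ u⁻¹` of `G` on its Lie algebra. -/
def Ad (u : G.grp) (ξ : G.lie) : G.lie :=
  ⟨((u : GL (Fin n) ℂ) : Mat n) * ξ * (((u : GL (Fin n) ℂ)⁻¹ : GL (Fin n) ℂ) : Mat n), by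
    intro t
    have h : expGL (t • (((u : GL (Fin n) ℂ) : Mat n) * (ξ : Mat n) *
        (((u : GL (Fin n) ℂ)⁻¹ : GL (Fin n) ℂ) : Mat n)))
        = (u : GL (Fin n) ℂ) * expGL (t • (ξ : Mat n)) * (u : GL (Fin n) ℂ)⁻¹ := by
      apply Units.ext
      have := Matrix.exp_units_conj (u : GL (Fin n) ℂ) (t • (ξ : Mat n))
      simpa using this
    rw [h]
    exact G.grp.mul_mem (G.grp.mul_mem u.2 (ξ.2 t)) (G.grp.inv_mem u.2)⟩

/-- The complexification `Gᶜ` of `G`: the smallest Lie subgroup (that is, closed subgroup) of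
`GL(n, ℂ)` that contains `exp (i η) u` for all `u ∈ G` and `η ∈ 𝔤`. (The set of these products is
itself a closed subgroup, so it is equal to `Gᶜ`.) -/
def complexification : Subgroup (GL (Fin n) ℂ) :=
  (Subgroup.closure {g | ∃ u ∈ G.grp, ∃ η ∈ G.lie, g = expGL (Complex.I • η) * u}).topologicalClosure

theorem exp_I_mul_mem (u : GL (Fin n) ℂ) (hu : u ∈ G.grp) (η : Mat n) (hη : η ∈ G.lie) :
    expGL (Complex.I • η) * u ∈ G.complexification :=
  Subgroup.le_topologicalClosure _ (Subgroup.subset_closure ⟨u, hu, η, hη, rfl⟩)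

theorem le_complexification : G.grp ≤ G.complexification := by
  intro u hu
  have h := G.exp_I_mul_mem u hu 0 G.lie.zero_mem
  have h0 : expGL (Complex.I • (0 : Mat n)) = 1 := Units.ext (by simp)
  rwa [h0, one_mul] at h

end CompactUnitaryGroup

section Manifold

variable {E : Type*} [NormedAddCommGroup E] [NormedSpace ℂ E]
variable {X : Type*} [TopologicalSpace X] [ChartedSpace E X]

/-- The real tangent space `T_x X` of a complex manifold `X` modelled on `E`. -/
abbrev RT (E : Type*) [NormedAddCommGroup E] [NormedSpace ℂ E]
    {X : Type*} [TopologicalSpace X] [ChartedSpace E X] (x : X) : Type _ :=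
  TangentSpace 𝓘(ℝ, E) x

/-- The complex structure `J` on `T_x X`: multiplication by `i` in a holomorphic chart. -/
def J (x : X) : RT E x →L[ℝ] RT E x :=
  (Complex.I • ContinuousLinearMap.id ℝ E : E →L[ℝ] E)

/-- The expression in the chart `e` of a differential 2-form `σ` on `X`, that is, the pullback of
`σ` by `e⁻¹`. -/
def localForm (σ : ∀ x : X, RT E x [⋀^Fin 2]→L[ℝ] ℝ) (e : OpenPartialHomeomorph X E) :
    E → E [⋀^Fin 2]→L[ℝ] ℝ :=
  fun y => (σ (e.symm y)).compContinuousLinearMap (mfderiv 𝓘(ℝ, E) 𝓘(ℝ, E) e.symm y)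

variable (E X) in
/-- A Kähler structure on the complex manifold `X`: a smooth closed 2-form `ω` that is compatible
with `J`, so that `⟨v, w⟩ = ω (v, J w)` is a Riemannian metric. -/
structure KahlerStructure where
  /-- the symplectic form -/
  form : ∀ x : X, RT E x [⋀^Fin 2]→L[ℝ] ℝ
  smooth : ∀ e ∈ atlas E X, ContDiffOn ℝ ∞ (localForm form e) e.target
  closed : ∀ e ∈ atlas E X, ∀ y ∈ e.target, extDeriv (localForm form e) y = 0
  metric_symm : ∀ (x : X) (v w : RT E x), form x ![v, J x w] = form x ![w, J x v]
  metric_pos : ∀ (x : X) (v : RT E x), v ≠ 0 → 0 < form x ![v, J x v]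

variable {n : ℕ}

/-- The array of entries of an invertible matrix, a point of the normed space `ℂ^(n × n)`. -/
def entries (g : GL (Fin n) ℂ) : Fin n → Fin n → ℂ := fun i j => (g : Mat n) i j

open Classical in
/-- The action map `(g, x) ↦ g x` of a matrix group `H`, as a function of the matrix `g` and of
the point `x`. (The value at matrices outside `H` is irrelevant.) -/
def actionMap {X : Type*} (H : Subgroup (GL (Fin n) ℂ)) [MulAction H X]
    (p : (Fin n → Fin n → ℂ) × X) : X :=
  if h : ∃ g : H, entries (g : GL (Fin n) ℂ) = p.1 then h.choose • p.2 else p.2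

theorem actionMap_entries {X : Type*} (H : Subgroup (GL (Fin n) ℂ)) [MulAction H X] (g : H)
    (x : X) : actionMap H (entries (g : GL (Fin n) ℂ), x) = g • x := by
  have h : ∃ g' : H, entries (g' : GL (Fin n) ℂ) = entries (g : GL (Fin n) ℂ) := ⟨g, rfl⟩
  have h' : h.choose = g := Subtype.ext (Units.ext h.choose_spec)
  rw [actionMap, dif_pos h, h']

/-- The subset `H × X` of `ℂ^(n × n) × X`, which is a closed submanifold of `GL(n, ℂ) × X` when `H`
is a Lie subgroup of `GL(n, ℂ)`. -/
def groupTimes (H : Subgroup (GL (Fin n) ℂ)) (X : Type*) : Set ((Fin n → Fin n → ℂ) × X) :=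
  {p | ∃ g ∈ H, entries g = p.1}

variable (E X) in
/-- The action map `H × X → X` of the Lie group `H` is smooth. Smoothness on the submanifold
`H × X` is expressed through `ContMDiffOn`, as for local extensions to the ambient manifold. -/
def IsSmoothAction (H : Subgroup (GL (Fin n) ℂ)) [MulAction H X] : Prop :=
  ContMDiffOn (𝓘(ℝ, Fin n → Fin n → ℂ).prod 𝓘(ℝ, E)) 𝓘(ℝ, E) ∞ (actionMap H) (groupTimes H X)

variable (E X) in
/-- The action map `H × X → X` of the complex Lie group `H` is holomorphic. -/
def IsHolomorphicAction (H : Subgroup (GL (Fin n) ℂ)) [MulAction H X] : Prop :=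
  ContMDiffOn (𝓘(ℂ, Fin n → Fin n → ℂ).prod 𝓘(ℂ, E)) 𝓘(ℂ, E) ∞ (actionMap H) (groupTimes H X)

/-- `G` acts on the Kähler manifold `X` by Kähler isometries: the action is smooth
and preserves both `ω` and `J` (hence also the metric `ω (·, J ·)`). -/
structure IsKahlerAction (K : KahlerStructure E X) (G : CompactUnitaryGroup n)
    [MulAction G.grp X] : Prop where
  smooth : IsSmoothAction E X G.grp
  preserves_form : ∀ (u : G.grp) (x : X) (v w : RT E x),
    K.form (u • x) ![mfderiv 𝓘(ℝ, E) 𝓘(ℝ, E) (fun y : X => u • y) x v,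
      mfderiv 𝓘(ℝ, E) 𝓘(ℝ, E) (fun y : X => u • y) x w] = K.form x ![v, w]
  preserves_J : ∀ (u : G.grp) (x : X) (v : RT E x),
    mfderiv 𝓘(ℝ, E) 𝓘(ℝ, E) (fun y : X => u • y) x (J x v) =
      J (u • x) (mfderiv 𝓘(ℝ, E) 𝓘(ℝ, E) (fun y : X => u • y) x v)

variable (E) in
/-- The infinitesimal action `v_ξ(x) = d/dt exp (t ξ) x` at `t = 0`, for `ξ ∈ 𝔤`. -/
def infAction (G : CompactUnitaryGroup n) [MulAction G.grp X] (ξ : G.lie) (x : X) : RT E x :=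
  (mfderiv 𝓘(ℝ, ℝ) 𝓘(ℝ, E)
    (fun t : ℝ => (⟨expGL (t • (ξ : Mat n)), ξ.2 t⟩ : G.grp) • x) 0 : ℝ →L[ℝ] E) (1 : ℝ)

/-- An inner product on the Lie algebra that is invariant under the adjoint action. -/
structure InvariantInner (G : CompactUnitaryGroup n) where
  core : InnerProductSpace.Core ℝ G.lie
  invariant : ∀ (u : G.grp) (ξ η : G.lie), core.inner (G.Ad u ξ) (G.Ad u η) = core.inner ξ η

/-- The inner product `⟨ξ, η⟩` of two elements of the Lie algebra. -/
def InvariantInner.ip {G : CompactUnitaryGroup n} (B : InvariantInner G) (ξ η : G.lie) : ℝ :=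
  B.core.inner ξ η

/-- The norm `|ξ|` of the inner product. -/
def InvariantInner.norm {G : CompactUnitaryGroup n} (B : InvariantInner G) (ξ : G.lie) : ℝ :=
  √(B.ip ξ ξ)

/-- `μ : X → 𝔤` is an equivariant moment map: for each `ξ ∈ 𝔤` the function `H_ξ = ⟨μ, ξ⟩` is
smooth with differential `ω (v_ξ, ·)`, and `μ (u x) = u μ(x) u⁻¹` for `u ∈ G`. -/
structure IsMomentMap (K : KahlerStructure E X) (G : CompactUnitaryGroup n) [MulAction G.grp X]
    (B : InvariantInner G) (μ : X → G.lie) : Prop where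
  smooth : ∀ ξ : G.lie, ContMDiff 𝓘(ℝ, E) 𝓘(ℝ, ℝ) ∞ (fun x => B.ip (μ x) ξ)
  hamiltonian : ∀ (ξ : G.lie) (x : X) (v : RT E x),
    (mfderiv 𝓘(ℝ, E) 𝓘(ℝ, ℝ) (fun y => B.ip (μ y) ξ) x v : ℝ) =
      K.form x ![infAction E G ξ x, v]
  equivariant : ∀ (u : G.grp) (x : X), μ (u • x) = G.Ad u (μ x)

variable (E) in
/-- The action of `Gᶜ` on `X` is the complexification of the action of `G`: it is a holomorphic
action that extends the one of `G`. -/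
structure IsComplexifiedAction (G : CompactUnitaryGroup n) [MulAction G.grp X]
    [MulAction G.complexification X] : Prop where
  extends_action : ∀ (u : G.grp) (x : X),
    (⟨u, G.le_complexification u.2⟩ : G.complexification) • x = u • x
  holomorphic : IsHolomorphicAction E X G.complexification

variable (E) in
/-- `x` is a critical point of the moment map squared `f = ½ |μ|²`. -/
def IsCriticalPoint {G : CompactUnitaryGroup n} (B : InvariantInner G) (μ : X → G.lie)
    (x : X) : Prop :=
  mfderiv 𝓘(ℝ, E) 𝓘(ℝ, ℝ) (fun y => (1 / 2 : ℝ) * B.norm (μ y) ^ 2) x = 0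

end Manifold

end KirwanNess

end

/-! Put ξ = μ(x). The differential of f at x is ω(v_ξ(x), ·). At a critical point it vanishes, and
pairing it with J v_ξ(x) gives v_ξ(x) = 0, so every exp(zξ) with z complex fixes x. Hence k =
exp(-itξ) g⁻¹ carries y = gx to x for every t ≥ 0.

Write k = exp(iζ) u with ζ ∈ 𝔤 and u ∈ G. Along s ↦ exp(isη) y the function ⟨μ, η⟩ has derivative
ω(v_η, J v_η) ≥ 0. Taking η = u⁻¹ζu and using equivariance gives -|μ(y)| |ζ| ≤ ⟨μ(x), ζ⟩
(`exists_neg_norm_mul_le_ip`). Moreover ζ = -tξ + O(1) uniformly in t, because exp(2iζ) = k k* is a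
conjugate of a fixed positive matrix by exp(-itξ) and the logarithm is operator monotone
(`exists_norm_polar_add_smul_le`). Therefore t|ξ|² - O(1) ≤ |μ(y)| (t|ξ| + O(1)), and t → ∞ gives
|ξ| ≤ |μ(y)|.

The polar decomposition (`exists_polar`) has to be proved, since Gᶜ is defined as a generated closed
subgroup. Its elements lie in the Zariski closure Z of G, which is stable under g ↦ g*. Averaging
over Haar measure shows that G is exactly the unitary part of Z (`mem_of_mem_zariskiClosure`). If g
g* = exp A with A Hermitian, regular functions along z ↦ exp(zA) are exponential polynomials with
real exponents; those that vanish on ℕ are zero, so all exp(zA) lie in Z. Then exp(-A/2) g and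
exp(-itA/2) are unitary elements of Z, that is, elements of G. -/

noncomputable section

namespace KirwanNess

variable {n : ℕ}

/-! ### Regular functions on GL(n, ℂ) and their averages -/

section RegularFunctions

/-- The algebra of regular functions on `GL(n, ℂ)`: the polynomials in the entries of `g` and of
`g⁻¹`. -/
def regular (n : ℕ) : Subalgebra ℂ (GL (Fin n) ℂ → ℂ) :=
  Algebra.adjoin ℂ ({f | ∃ i j, f = fun g : GL (Fin n) ℂ => (g : Mat n) i j} ∪
    {f | ∃ i j, f = fun g : GL (Fin n) ℂ => ((g⁻¹ : GL (Fin n) ℂ) : Mat n) i j})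

theorem entry_mem_regular (i j : Fin n) : (fun g : GL (Fin n) ℂ => (g : Mat n) i j) ∈ regular n :=
  Algebra.subset_adjoin (Or.inl ⟨i, j, rfl⟩)

theorem inv_entry_mem_regular (i j : Fin n) :
    (fun g : GL (Fin n) ℂ => ((g⁻¹ : GL (Fin n) ℂ) : Mat n) i j) ∈ regular n :=
  Algebra.subset_adjoin (Or.inr ⟨i, j, rfl⟩)

theorem const_mem_regular (c : ℂ) : (fun _ : GL (Fin n) ℂ => c) ∈ regular n :=
  (regular n).algebraMap_mem c

/-- Induction principle for regular functions. -/
theorem regular_induction {P : (GL (Fin n) ℂ → ℂ) → Prop}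
    (entry : ∀ i j, P fun g : GL (Fin n) ℂ => (g : Mat n) i j)
    (inv_entry : ∀ i j, P fun g : GL (Fin n) ℂ => ((g⁻¹ : GL (Fin n) ℂ) : Mat n) i j)
    (const : ∀ c, P fun _ => c) (add : ∀ f g, P f → P g → P (f + g))
    (mul : ∀ f g, P f → P g → P (f * g)) {f : GL (Fin n) ℂ → ℂ} (hf : f ∈ regular n) : P f := by
  induction hf using Algebra.adjoin_induction with
  | mem x hx =>
    rcases hx with ⟨i, j, rfl⟩ | ⟨i, j, rfl⟩
    exacts [entry i j, inv_entry i j]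
  | algebraMap r => exact const r
  | add x y _ _ hx hy => exact add x y hx hy
  | mul x y _ _ hx hy => exact mul x y hx hy

theorem sum_mem_regular {ι : Type*} (s : Finset ι) (f : ι → GL (Fin n) ℂ → ℂ)
    (hf : ∀ i ∈ s, f i ∈ regular n) : (fun g => ∑ i ∈ s, f i g) ∈ regular n := by
  have := (regular n).sum_mem hf
  convert this using 1
  ext g
  simp

theorem continuous_of_mem_regular {f : GL (Fin n) ℂ → ℂ} (hf : f ∈ regular n) : Continuous f := by
  refine regular_induction (P := Continuous) ?_ ?_ ?_ ?_ ?_ hf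
  · intro i j
    exact (Units.continuous_val).matrix_elem i j
  · intro i j
    exact (Units.continuous_val.comp continuous_inv).matrix_elem i j
  · intro c; exact continuous_const
  · intro f g hf hg; exact hf.add hg
  · intro f g hf hg; exact hf.mul hg

theorem comp_inv_mem_regular {f : GL (Fin n) ℂ → ℂ} (hf : f ∈ regular n) :
    (fun g => f g⁻¹) ∈ regular n := by
  refine regular_induction (P := fun f => (fun g => f g⁻¹) ∈ regular n) ?_ ?_ ?_ ?_ ?_ hf
  · exact inv_entry_mem_regular
  · intro i j
    simpa using entry_mem_regular i j
  · exact const_mem_regular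
  · intro f g hf hg; exact (regular n).add_mem hf hg
  · intro f g hf hg; exact (regular n).mul_mem hf hg

theorem comp_mul_left_mem_regular {f : GL (Fin n) ℂ → ℂ} (hf : f ∈ regular n) (a : GL (Fin n) ℂ) :
    (fun g => f (a * g)) ∈ regular n := by
  refine regular_induction (P := fun f => (fun g => f (a * g)) ∈ regular n) ?_ ?_ ?_ ?_ ?_ hf
  · intro i j
    simp only [Units.val_mul, Matrix.mul_apply]
    exact sum_mem_regular _ _ fun k _ =>
      (regular n).mul_mem (const_mem_regular _) (entry_mem_regular k j)
  · intro i j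
    simp only [mul_inv_rev, Units.val_mul, Matrix.mul_apply]
    exact sum_mem_regular _ _ fun k _ =>
      (regular n).mul_mem (inv_entry_mem_regular i k) (const_mem_regular _)
  · exact const_mem_regular
  · intro f g hf hg; exact (regular n).add_mem hf hg
  · intro f g hf hg; exact (regular n).mul_mem hf hg

theorem comp_mul_right_mem_regular {f : GL (Fin n) ℂ → ℂ} (hf : f ∈ regular n)
    (a : GL (Fin n) ℂ) : (fun g => f (g * a)) ∈ regular n := by
  simpa using comp_inv_mem_regular (comp_mul_left_mem_regular (comp_inv_mem_regular hf) a⁻¹)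

/-- Conjugating the values undoes the conjugation in g*, which leaves a polynomial in transposed
entries. This makes the Zariski closure stable under the adjoint. -/
theorem star_comp_star_mem_regular {f : GL (Fin n) ℂ → ℂ} (hf : f ∈ regular n) :
    (fun g => star (f (star g))) ∈ regular n := by
  refine regular_induction (P := fun f => (fun g => star (f (star g))) ∈ regular n)
    ?_ ?_ ?_ ?_ ?_ hf
  · intro i j
    simpa [Matrix.star_eq_conjTranspose] using entry_mem_regular j i
  · intro i j
    have : (fun g : GL (Fin n) ℂ => star ((((star g)⁻¹ : GL (Fin n) ℂ) : Mat n) i j)) =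
        fun g : GL (Fin n) ℂ => ((g⁻¹ : GL (Fin n) ℂ) : Mat n) j i := by
      ext g
      rw [← star_inv, Units.coe_star, Matrix.star_apply, star_star]
    rw [this]
    exact inv_entry_mem_regular j i
  · intro c; exact const_mem_regular _
  · intro f g hf hg
    simp only [Pi.add_apply, star_add]
    exact (regular n).add_mem hf hg
  · intro f g hf hg
    simp only [Pi.mul_apply, star_mul']
    exact (regular n).mul_mem hf hg

/-- The products `a(x) b(g)` of regular functions. -/
def splitProducts (n : ℕ) : Submonoid (GL (Fin n) ℂ × GL (Fin n) ℂ → ℂ) where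
  carrier := {F | ∃ a ∈ regular n, ∃ b ∈ regular n, F = fun p => a p.1 * b p.2}
  one_mem' := ⟨1, (regular n).one_mem, 1, (regular n).one_mem, by ext; simp⟩
  mul_mem' := by
    rintro _ _ ⟨a, ha, b, hb, rfl⟩ ⟨c, hc, d, hd, rfl⟩
    refine ⟨a * c, (regular n).mul_mem ha hc, b * d, (regular n).mul_mem hb hd, ?_⟩
    ext p
    simp only [Pi.mul_apply]
    ring

/-- The comultiplication of the coordinate ring: once the variables are separated, integrating out
the second leaves a regular function of the first. -/
theorem comp_mul_mem_span {f : GL (Fin n) ℂ → ℂ} (hf : f ∈ regular n) :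
    (fun p : GL (Fin n) ℂ × GL (Fin n) ℂ => f (p.1 * p.2)) ∈
      Submodule.span ℂ (splitProducts n : Set (GL (Fin n) ℂ × GL (Fin n) ℂ → ℂ)) := by
  -- The split products are closed under multiplication, so their span is an algebra and the
  -- induction over sums and products applies.
  have hspan : Submodule.span ℂ (splitProducts n : Set (GL (Fin n) ℂ × GL (Fin n) ℂ → ℂ)) =
      Subalgebra.toSubmodule
        (Algebra.adjoin ℂ (splitProducts n : Set (GL (Fin n) ℂ × GL (Fin n) ℂ → ℂ))) := by
    rw [Algebra.adjoin_eq_span, Submonoid.closure_eq]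
  rw [hspan, Subalgebra.mem_toSubmodule]
  set S := Algebra.adjoin ℂ (splitProducts n : Set (GL (Fin n) ℂ × GL (Fin n) ℂ → ℂ))
  have hmul : ∀ a ∈ regular n, ∀ b ∈ regular n,
      (fun p : GL (Fin n) ℂ × GL (Fin n) ℂ => a p.1 * b p.2) ∈ S :=
    fun a ha b hb => Algebra.subset_adjoin ⟨a, ha, b, hb, rfl⟩
  have hsum : ∀ F : Fin n → GL (Fin n) ℂ × GL (Fin n) ℂ → ℂ, (∀ k, F k ∈ S) →
      (fun p => ∑ k, F k p) ∈ S := by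
    intro F hF
    have := S.sum_mem (t := Finset.univ) (fun k _ => hF k)
    convert this using 1
    ext p
    simp
  refine regular_induction (P := fun f => (fun p : GL (Fin n) ℂ × GL (Fin n) ℂ =>
    f (p.1 * p.2)) ∈ S) ?_ ?_ ?_ ?_ ?_ hf
  · intro i j
    simp only [Units.val_mul, Matrix.mul_apply]
    exact hsum _ fun k => hmul _ (entry_mem_regular i k) _ (entry_mem_regular k j)
  · intro i j
    simp only [mul_inv_rev, Units.val_mul, Matrix.mul_apply]
    refine hsum _ fun k => ?_
    simpa only [mul_comm] using
      hmul _ (inv_entry_mem_regular k j) _ (inv_entry_mem_regular i k)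
  · intro c; exact S.algebraMap_mem c
  · intro f g hf hg; exact S.add_mem hf hg
  · intro f g hf hg; exact S.mul_mem hf hg

open MeasureTheory in
/-- The average of the translates of a regular function is regular. -/
theorem integral_comp_mul_mem_regular {f : GL (Fin n) ℂ → ℂ} (hf : f ∈ regular n)
    {K : Type*} [TopologicalSpace K] [CompactSpace K] [MeasurableSpace K] [BorelSpace K]
    (ν : Measure K) [IsFiniteMeasure ν] (φ : K → GL (Fin n) ℂ) (hφ : Continuous φ) :
    (fun x => ∫ k, f (x * φ k) ∂ν) ∈ regular n := by
  -- Continuity is carried through the induction because additivity of the integral needs both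
  -- summands to be integrable.
  have key : ∀ F ∈ Submodule.span ℂ
      (splitProducts n : Set (GL (Fin n) ℂ × GL (Fin n) ℂ → ℂ)),
      (∀ x, Continuous fun k => F (x, φ k)) ∧ (fun x => ∫ k, F (x, φ k) ∂ν) ∈ regular n := by
    intro F hF
    have hint : ∀ h : K → ℂ, Continuous h → Integrable h ν := fun h hh =>
      hh.integrable_of_hasCompactSupport (HasCompactSupport.of_compactSpace h)
    induction hF using Submodule.span_induction with
    | mem F hF =>
      obtain ⟨a, ha, b, hb, rfl⟩ := hF
      refine ⟨fun x => (continuous_const (y := a x)).mul ((continuous_of_mem_regular hb).comp hφ), ?_⟩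
      simp only [integral_const_mul]
      exact (regular n).mul_mem ha (const_mem_regular _)
    | zero =>
      refine ⟨fun x => continuous_const, ?_⟩
      simpa using const_mem_regular 0
    | add F F' _ _ h h' =>
      refine ⟨fun x => (h.1 x).add (h'.1 x), ?_⟩
      have : (fun x => ∫ k, (F + F') (x, φ k) ∂ν) =
          (fun x => ∫ k, F (x, φ k) ∂ν) + fun x => ∫ k, F' (x, φ k) ∂ν := by
        ext x
        exact integral_add (hint _ (h.1 x)) (hint _ (h'.1 x))
      rw [this]
      exact (regular n).add_mem h.2 h'.2
    | smul c F _ h =>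
      refine ⟨fun x => continuous_const.mul (h.1 x), ?_⟩
      simp only [Pi.smul_apply, smul_eq_mul, integral_const_mul]
      exact (regular n).mul_mem (const_mem_regular _) h.2
  exact (key _ (comp_mul_mem_span hf)).2

end RegularFunctions

/-! ### The Zariski closure of G -/

section Hull

variable (G : CompactUnitaryGroup n)

/-- The Zariski closure of `G` in `GL(n, ℂ)`. -/
def zariskiClosure : Subgroup (GL (Fin n) ℂ) where
  carrier := {g | ∀ f ∈ regular n, (∀ u ∈ G.grp, f u = 0) → f g = 0}
  one_mem' := fun _ _ h => h 1 G.grp.one_mem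
  mul_mem' := by
    intro g h hg hh f hf hz
    -- Two passes: right translates by v ∈ G show that f(gv) = 0, and then x ↦ f(gx) vanishes on G,
    -- hence at h.
    refine hh (fun x => f (g * x)) (comp_mul_left_mem_regular hf g) fun v hv => ?_
    exact hg (fun x => f (x * v)) (comp_mul_right_mem_regular hf v)
      fun u hu => hz _ (G.grp.mul_mem hu hv)
  inv_mem' := by
    intro g hg f hf hz
    exact hg (fun x => f x⁻¹) (comp_inv_mem_regular hf) fun u hu => hz _ (G.grp.inv_mem hu)

theorem le_zariskiClosure : G.grp ≤ zariskiClosure G := fun u hu _ _ h => h u hu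

theorem isClosed_zariskiClosure : IsClosed (zariskiClosure G : Set (GL (Fin n) ℂ)) := by
  have : (zariskiClosure G : Set (GL (Fin n) ℂ)) =
      ⋂ f ∈ {f | f ∈ regular n ∧ ∀ u ∈ G.grp, f u = 0}, f ⁻¹' {0} := by
    ext g
    simp only [mem_iInter, mem_ofPred_eq, mem_preimage, mem_singleton_iff, and_imp]
    rfl
  rw [this]
  exact isClosed_biInter fun f hf =>
    isClosed_singleton.preimage (continuous_of_mem_regular hf.1)

theorem star_eq_inv_of_mem {u : GL (Fin n) ℂ} (hu : (u : Mat n) ∈ Matrix.unitaryGroup (Fin n) ℂ) :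
    star u = u⁻¹ := by
  rw [eq_inv_iff_mul_eq_one]
  exact Units.ext (by simpa using Matrix.mem_unitaryGroup_iff'.1 hu)

theorem star_mem_zariskiClosure {g : GL (Fin n) ℂ} (hg : g ∈ zariskiClosure G) :
    star g ∈ zariskiClosure G := by
  intro f hf hz
  have := hg _ (star_comp_star_mem_regular hf) fun u hu => by
    rw [star_eq_inv_of_mem (G.unitary u hu), hz _ (G.grp.inv_mem hu), star_zero]
  simpa using this

end Hull

/-! ### G is the unitary part of its Zariski closure -/

section Separation

variable (G : CompactUnitaryGroup n)

open scoped Pointwise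

/-- The restrictions to a set `T` of unitary matrices of the regular functions. -/
def restrictedRegular (T : Set (GL (Fin n) ℂ))
    (hT : ∀ t ∈ T, (t : Mat n) ∈ Matrix.unitaryGroup (Fin n) ℂ) : StarSubalgebra ℂ C(T, ℂ) where
  carrier := {F | ∃ f ∈ regular n, ∀ t : T, F t = f t}
  mul_mem' := by
    rintro F F' ⟨f, hf, h⟩ ⟨f', hf', h'⟩
    exact ⟨f * f', (regular n).mul_mem hf hf', fun t => by simp [h, h']⟩
  add_mem' := by
    rintro F F' ⟨f, hf, h⟩ ⟨f', hf', h'⟩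
    exact ⟨f + f', (regular n).add_mem hf hf', fun t => by simp [h, h']⟩
  algebraMap_mem' := fun c => ⟨_, const_mem_regular c, fun t => rfl⟩
  star_mem' := by
    rintro F ⟨f, hf, h⟩
    -- On unitary matrices (t⁻¹)* = t, so the conjugate of f agrees on T with a regular function.
    refine ⟨_, comp_inv_mem_regular (star_comp_star_mem_regular hf), fun t => ?_⟩
    rw [← star_eq_inv_of_mem (hT t t.2), star_star]
    simp [h]

theorem restrictedRegular_separatesPoints (T : Set (GL (Fin n) ℂ))
    (hT : ∀ t ∈ T, (t : Mat n) ∈ Matrix.unitaryGroup (Fin n) ℂ) :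
    (restrictedRegular T hT).SeparatesPoints := by
  intro s t hst
  obtain ⟨i, j, hij⟩ : ∃ i j, ((s : GL (Fin n) ℂ) : Mat n) i j ≠ ((t : GL (Fin n) ℂ) : Mat n) i j := by
    by_contra! h
    exact hst (Subtype.ext (Units.ext (Matrix.ext h)))
  have hc : Continuous fun g : T => ((g : GL (Fin n) ℂ) : Mat n) i j :=
    (continuous_of_mem_regular (entry_mem_regular i j)).comp continuous_subtype_val
  exact ⟨_, ⟨⟨_, hc⟩, ⟨_, entry_mem_regular i j, fun _ => rfl⟩, rfl⟩, hij⟩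

/-- A unitary matrix outside `G` is almost separated from `G` by a regular function. -/
theorem exists_regular_approx {h : GL (Fin n) ℂ}
    (hh : (h : Mat n) ∈ Matrix.unitaryGroup (Fin n) ℂ) (hG : h ∉ G.grp) :
    ∃ f ∈ regular n, (∀ u ∈ G.grp, ‖f u‖ ≤ 1 / 3) ∧ ∀ u ∈ G.grp, ‖f (h * u) - 1‖ ≤ 1 / 3 := by
  let T : Set (GL (Fin n) ℂ) := (G.grp : Set (GL (Fin n) ℂ)) ∪ (fun u => h * u) '' G.grp
  have hcpt : IsCompact ((fun u => h * u) '' (G.grp : Set (GL (Fin n) ℂ))) :=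
    G.compact.image (continuous_const_mul h)
  have hTc : IsCompact T := G.compact.union hcpt
  have hT : ∀ t ∈ T, (t : Mat n) ∈ Matrix.unitaryGroup (Fin n) ℂ := by
    rintro t (ht | ⟨u, hu, rfl⟩)
    · exact G.unitary t ht
    · rw [Units.val_mul]
      exact mul_mem hh (G.unitary u hu)
  have hdisj : ∀ t ∈ (fun u => h * u) '' (G.grp : Set (GL (Fin n) ℂ)), t ∉ G.grp := by
    rintro _ ⟨u, hu, rfl⟩ hmem
    exact hG ((G.grp.mul_mem_cancel_right hu).1 hmem)
  have : CompactSpace T := isCompact_iff_compactSpace.1 hTc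
  let S : Set T := {t | (t : GL (Fin n) ℂ) ∈ G.grp}
  have hS : IsClopen S := by
    refine ⟨G.compact.isClosed.preimage continuous_subtype_val, ?_⟩
    have : S = (Subtype.val ⁻¹' ((fun u => h * u) '' (G.grp : Set (GL (Fin n) ℂ))))ᶜ := by
      ext t
      refine ⟨fun ht ht' => hdisj _ ht' ht, fun ht => ?_⟩
      exact t.2.resolve_right ht
    rw [this]
    exact (hcpt.isClosed.preimage continuous_subtype_val).isOpen_compl
  classical
  -- The indicator of the coset hG is continuous on T because G and hG are disjoint compact sets;
  -- Stone–Weierstrass approximates it within 1/3.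
  let χ : C(T, ℂ) := ⟨fun t => if t ∈ S then 0 else 1, by
    refine continuous_const.if ?_ continuous_const
    intro a ha
    have : frontier S = ∅ := hS.frontier_eq
    simp only [ofPred_mem_eq, this] at ha
    exact ha.elim⟩
  have hχ : χ ∈ (restrictedRegular T hT).topologicalClosure := by
    rw [ContinuousMap.starSubalgebra_topologicalClosure_eq_top_of_separatesPoints _
      (restrictedRegular_separatesPoints T hT)]
    trivial
  obtain ⟨F, ⟨f, hf, hFf⟩, hF⟩ := Metric.mem_closure_iff.1 hχ (1 / 3) (by norm_num)
  have hle : ∀ t : T, ‖f t - χ t‖ ≤ 1 / 3 := by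
    intro t
    have h1 := (ContinuousMap.dist_apply_le_dist (f := χ) (g := F) t).trans hF.le
    rwa [dist_comm, dist_eq_norm, hFf] at h1
  refine ⟨f, hf, fun u hu => ?_, fun u hu => ?_⟩
  · have h1 := hle ⟨u, Or.inl hu⟩
    have h2 : χ ⟨u, Or.inl hu⟩ = 0 := if_pos hu
    rwa [h2, sub_zero] at h1
  · have hm : h * u ∈ (fun u => h * u) '' (G.grp : Set (GL (Fin n) ℂ)) := ⟨u, hu, rfl⟩
    have h1 := hle ⟨h * u, Or.inr hm⟩
    have h2 : χ ⟨h * u, Or.inr hm⟩ = 1 := if_neg (hdisj _ hm)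
    rwa [h2] at h1

open MeasureTheory in
/-- The unitary matrices in the Zariski closure of `G` belong to `G`. -/
theorem mem_of_mem_zariskiClosure {h : GL (Fin n) ℂ} (hz : h ∈ zariskiClosure G)
    (hh : (h : Mat n) ∈ Matrix.unitaryGroup (Fin n) ℂ) : h ∈ G.grp := by
  by_contra hG
  obtain ⟨f, hf, hf0, hf1⟩ := exists_regular_approx G hh hG
  have : CompactSpace G.grp := isCompact_iff_compactSpace.1 G.compact
  let _ : MeasurableSpace G.grp := borel _
  have : BorelSpace G.grp := ⟨rfl⟩
  let ν : Measure G.grp := Measure.haarMeasure ⊤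
  have hν : ν univ = 1 := by
    simpa using Measure.haarMeasure_self (G := G.grp) (K₀ := ⊤)
  have : IsProbabilityMeasure ν := ⟨hν⟩
  have hreg := integral_comp_mul_mem_regular hf ν
    (fun u : G.grp => (u : GL (Fin n) ℂ)) continuous_subtype_val
  -- Averaging makes the function constant on G, hence on the Zariski closure, while keeping the
  -- values near 0 at the identity and near 1 at h.
  set P : GL (Fin n) ℂ → ℂ := fun x => ∫ u : G.grp, f (x * u) ∂ν
  have hconst : ∀ v ∈ G.grp, P v = P 1 := by
    intro v hv
    have := integral_mul_left_eq_self (μ := ν) (fun u : G.grp => f u) ⟨v, hv⟩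
    simpa [P] using this
  have hint : Integrable (fun u : G.grp => f (h * u)) ν := by
    refine Continuous.integrable_of_hasCompactSupport ?_ (HasCompactSupport.of_compactSpace _)
    exact (continuous_of_mem_regular hf).comp (by fun_prop)
  have h1 : ‖P 1‖ ≤ 1 / 3 := by
    have := norm_integral_le_of_norm_le_const (μ := ν) (f := fun u : G.grp => f (1 * u))
      (C := 1 / 3) (Eventually.of_forall fun u => by simpa using hf0 u u.2)
    simpa [P] using this
  have h2 : ‖P h - 1‖ ≤ 1 / 3 := by
    have := norm_integral_le_of_norm_le_const (μ := ν) (f := fun u : G.grp => f (h * u) - 1)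
      (C := 1 / 3) (Eventually.of_forall fun u => hf1 u u.2)
    rw [integral_sub hint (integrable_const _)] at this
    simpa [P] using this
  have h3 : P h - P 1 = 0 :=
    hz (fun x => P x - P 1) ((regular n).sub_mem hreg (const_mem_regular _))
      fun u hu => by rw [hconst u hu, sub_self]
  have h4 : (1 : ℂ) = P 1 - (P h - 1) + (P h - P 1) := by ring
  have h5 : ‖(1 : ℂ)‖ ≤ 1 / 3 + 1 / 3 := by
    rw [h4, h3, add_zero]
    exact (norm_sub_le _ _).trans (add_le_add h1 h2)
  norm_num at h5

end Separation

/-! ### Exponential polynomials with real exponents -/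

section ExponentialPolynomials

/-- The function `z ↦ exp (a z)`, as a function of the real exponent `a`. -/
def expChar (a : ℝ) : ℂ → ℂ := fun z => Complex.exp (a * z)

/-- The exponential polynomials with real exponents. -/
def expPoly : Subalgebra ℂ (ℂ → ℂ) := Algebra.adjoin ℂ (range expChar)

theorem expChar_mem (a : ℝ) : expChar a ∈ expPoly := Algebra.subset_adjoin ⟨a, rfl⟩

theorem mem_span_of_mem_expPoly {f : ℂ → ℂ} (hf : f ∈ expPoly) :
    f ∈ Submodule.span ℂ (range expChar) := by
  let S : Submonoid (ℂ → ℂ) :=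
    { carrier := range expChar
      one_mem' := ⟨0, by ext z; simp [expChar]⟩
      mul_mem' := by
        rintro _ _ ⟨a, rfl⟩ ⟨b, rfl⟩
        exact ⟨a + b, by ext z; simp [expChar, ← Complex.exp_add, add_mul]⟩ }
  have h : Submonoid.closure (range expChar) = S := Submonoid.closure_eq S
  have := Algebra.adjoin_eq_span ℂ (range expChar)
  rw [h] at this
  change f ∈ Submodule.span ℂ (S : Set (ℂ → ℂ))
  rw [← this]
  exact hf

/-- An exponential polynomial that vanishes on a submonoid which tells the exponents apart is
zero. -/
theorem eq_zero_of_mem_expPoly {M : Type*} [AddMonoid M] (ι : M →+ ℂ)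
    (hι : ∀ a b : ℝ, (∀ m, expChar a (ι m) = expChar b (ι m)) → a = b) {f : ℂ → ℂ}
    (hf : f ∈ expPoly) (h0 : ∀ m, f (ι m) = 0) : f = 0 := by
  obtain ⟨c, rfl⟩ := Finsupp.mem_span_range_iff_exists_finsupp.1 (mem_span_of_mem_expPoly hf)
  let χ : ℝ → (Multiplicative M →* ℂ) := fun a =>
    { toFun := fun m => expChar a (ι m.toAdd)
      map_one' := by simp [expChar]
      map_mul' := fun m m' => by simp [expChar, mul_add, Complex.exp_add] }
  have hinj : Function.Injective χ := fun a b h =>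
    hι a b fun m => DFunLike.congr_fun h (Multiplicative.ofAdd m)
  -- Dedekind's independence of characters: distinct exponents restrict to distinct characters of M,
  -- so every coefficient vanishes.
  have hli := (linearIndependent_monoidHom (Multiplicative M) ℂ).comp χ hinj
  have hc : c = 0 := by
    refine linearIndependent_iff.1 hli c ?_
    ext m
    have := h0 m.toAdd
    simp only [Finsupp.sum, Finset.sum_apply, Pi.smul_apply] at this
    simp only [Finsupp.linearCombination_apply, Finsupp.sum, Finset.sum_apply, Pi.smul_apply]
    exact this
  simp [hc]

theorem eq_zero_of_forall_nat {f : ℂ → ℂ} (hf : f ∈ expPoly) (h0 : ∀ k : ℕ, f k = 0) : f = 0 := by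
  refine eq_zero_of_mem_expPoly (Nat.castAddMonoidHom ℂ) (fun a b h => ?_) hf h0
  have := h 1
  simp only [expChar, Nat.coe_castAddMonoidHom, Nat.cast_one, mul_one] at this
  exact Real.exp_injective (by exact_mod_cast this)

theorem eq_zero_of_forall_I {f : ℂ → ℂ} (hf : f ∈ expPoly) (h0 : ∀ t : ℝ, f (t * Complex.I) = 0) :
    f = 0 := by
  refine eq_zero_of_mem_expPoly ((AddMonoidHom.mulRight Complex.I).comp
    (Complex.ofRealHom : ℝ →+ ℂ)) (fun a b h => ?_) hf h0
  by_contra hab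
  have hab' : (a : ℂ) - b ≠ 0 := by
    rw [← Complex.ofReal_sub]
    exact Complex.ofReal_ne_zero.2 (sub_ne_zero.2 hab)
  -- At this parameter the quotient of the two characters is exp(πi) = -1, so they differ.
  have := h (Real.pi / (a - b))
  simp only [expChar] at this
  rw [← div_eq_one_iff_eq (Complex.exp_ne_zero _), ← Complex.exp_sub] at this
  have he : (a : ℂ) * ((((Real.pi / (a - b) : ℝ)) : ℂ) * Complex.I) -
      b * ((((Real.pi / (a - b) : ℝ)) : ℂ) * Complex.I) = Real.pi * Complex.I := by
    push_cast
    field_simp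
  have h2 := Complex.exp_pi_mul_I
  rw [← he] at h2
  have h3 := h2.symm.trans this
  norm_num at h3

end ExponentialPolynomials

/-! ### One-parameter groups of matrices -/

section Exponential

theorem expGL_zero : expGL (0 : Mat n) = 1 := Units.ext (by simp)

theorem expGL_add_of_commute {A B : Mat n} (h : Commute A B) :
    expGL (A + B) = expGL A * expGL B :=
  Units.ext (by simpa using Matrix.exp_add_of_commute A B h)

theorem expGL_add_smul (a b : ℂ) (A : Mat n) :
    expGL ((a + b) • A) = expGL (a • A) * expGL (b • A) := by
  rw [add_smul]
  exact expGL_add_of_commute (((Commute.refl A).smul_left a).smul_right b)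

theorem expGL_neg (A : Mat n) : expGL (-A) = (expGL A)⁻¹ := by
  rw [eq_inv_iff_mul_eq_one, ← expGL_add_of_commute (Commute.refl A).neg_left, neg_add_cancel,
    expGL_zero]

theorem expGL_nat_smul (k : ℕ) (A : Mat n) : expGL ((k : ℂ) • A) = expGL A ^ k := by
  refine Units.ext ?_
  rw [Nat.cast_smul_eq_nsmul, coe_expGL, Matrix.exp_nsmul, Units.val_pow_eq_pow_val, coe_expGL]

theorem star_expGL (A : Mat n) : star (expGL A) = expGL (star A) :=
  Units.ext (Matrix.exp_conjTranspose A).symm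

theorem units_conj_expGL (u : GL (Fin n) ℂ) (A : Mat n) :
    u * expGL A * u⁻¹ = expGL ((u : Mat n) * A * ((u⁻¹ : GL (Fin n) ℂ) : Mat n)) :=
  Units.ext (by simpa using (Matrix.exp_units_conj u A).symm)

open scoped Matrix.Norms.Operator in
theorem hasDerivAt_expGL (A : Mat n) :
    HasDerivAt (fun t : ℝ => (expGL (t • A) : Mat n)) A 0 := by
  have h := hasDerivAt_exp_smul_const (𝕂 := ℝ) A 0
  rw [zero_smul, NormedSpace.exp_zero, one_mul] at h
  exact h

open scoped Matrix.Norms.Operator in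
theorem eq_of_forall_expGL_eq {A B : Mat n} (h : ∀ t : ℝ, expGL (t • A) = expGL (t • B)) :
    A = B := by
  have h1 := hasDerivAt_expGL A
  simp only [h] at h1
  exact h1.unique (hasDerivAt_expGL B)

theorem expGL_mem_unitaryGroup_of_skew {A : Mat n} (h : star A = -A) :
    (expGL A : Mat n) ∈ Matrix.unitaryGroup (Fin n) ℂ := by
  rw [Matrix.mem_unitaryGroup_iff', ← Units.coe_star, star_expGL, h, ← Units.val_mul, expGL_neg,
    inv_mul_cancel, Units.val_one]

/-- The Lie algebra of `G ⊂ U(n)` consists of skew-Hermitian matrices. -/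
theorem CompactUnitaryGroup.star_eq_neg_of_mem_lie (G : CompactUnitaryGroup n) {ξ : Mat n}
    (hξ : ξ ∈ G.lie) : star ξ = -ξ := by
  refine eq_of_forall_expGL_eq fun t => ?_
  have h := star_eq_inv_of_mem (G.unitary _ (hξ t))
  rw [star_expGL, ← expGL_neg] at h
  simpa using h

/-- The entries of `exp (z A)` are exponential polynomials, for Hermitian `A`. -/
theorem expGL_entry_mem_expPoly {A : Mat n} (hA : A.IsHermitian) (i j : Fin n) :
    (fun z : ℂ => (expGL (z • A) : Mat n) i j) ∈ expPoly := by
  let U : Mat n := hA.eigenvectorUnitary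
  have hU : U * star U = 1 := Unitary.coe_mul_star_self hA.eigenvectorUnitary
  have hU' : star U * U = 1 := Unitary.coe_star_mul_self hA.eigenvectorUnitary
  let V : GL (Fin n) ℂ := ⟨U, star U, hU, hU'⟩
  have hA' : A = U * Matrix.diagonal (fun k => (hA.eigenvalues k : ℂ)) * star U := by
    have := hA.spectral_theorem
    rw [Unitary.conjStarAlgAut_apply] at this
    exact this
  have hexp : ∀ z : ℂ, (expGL (z • A) : Mat n) i j =
      ∑ k, (U i k * star (U j k)) * expChar (hA.eigenvalues k) z := by
    intro z
    have h1 : z • A = (V : Mat n) * Matrix.diagonal (fun k => z * (hA.eigenvalues k : ℂ)) *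
        ((V⁻¹ : GL (Fin n) ℂ) : Mat n) := by
      conv_lhs => rw [hA']
      rw [← smul_mul_assoc, ← mul_smul_comm, ← Matrix.diagonal_smul]
      rfl
    rw [h1, coe_expGL, Matrix.exp_units_conj, Matrix.exp_diagonal, Matrix.mul_apply]
    refine Finset.sum_congr rfl fun k _ => ?_
    rw [Matrix.mul_diagonal]
    change U i k * _ * star U k j = _
    rw [Matrix.star_apply, Pi.coe_exp, ← Complex.exp_eq_exp_ℂ, expChar, mul_comm z]
    ring
  have : (fun z : ℂ => (expGL (z • A) : Mat n) i j) =
      ∑ k, (U i k * star (U j k)) • expChar (hA.eigenvalues k) := by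
    ext z
    simp [hexp]
  rw [this]
  exact expPoly.sum_mem fun k _ => expPoly.smul_mem (expChar_mem _) _

theorem regular_comp_expGL_mem_expPoly {A : Mat n} (hA : A.IsHermitian) {f : GL (Fin n) ℂ → ℂ}
    (hf : f ∈ regular n) : (fun z : ℂ => f (expGL (z • A))) ∈ expPoly := by
  refine regular_induction (P := fun f => (fun z : ℂ => f (expGL (z • A))) ∈ expPoly)
    ?_ ?_ ?_ ?_ ?_ hf
  · exact expGL_entry_mem_expPoly hA
  · intro i j
    simp only [← expGL_neg, ← smul_neg]
    exact expGL_entry_mem_expPoly hA.neg i j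
  · intro c; exact expPoly.algebraMap_mem c
  · intro f g hf hg; exact expPoly.add_mem hf hg
  · intro f g hf hg; exact expPoly.mul_mem hf hg

end Exponential

/-! ### Polar decomposition of the complexification -/

section Polar

variable (G : CompactUnitaryGroup n)

/-- The powers of exp A lie in the group, so a defining function restricted to z ↦ exp(zA) vanishes
on ℕ, and therefore identically. -/
theorem expGL_smul_mem_zariskiClosure {A : Mat n} (hA : A.IsHermitian)
    (h : expGL A ∈ zariskiClosure G) (z : ℂ) : expGL (z • A) ∈ zariskiClosure G := by
  intro f hf hz
  refine congrFun (eq_zero_of_forall_nat (regular_comp_expGL_mem_expPoly hA hf) fun k => ?_) z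
  rw [expGL_nat_smul]
  exact (zariskiClosure G).pow_mem h k f hf hz

theorem isHermitian_I_smul {ξ : Mat n} (hξ : ξ ∈ G.lie) : (Complex.I • ξ).IsHermitian := by
  have h := G.star_eq_neg_of_mem_lie hξ
  rw [Matrix.star_eq_conjTranspose] at h
  rw [Matrix.IsHermitian, Matrix.conjTranspose_smul, h]
  simp

/-- The curve z ↦ exp(z iξ) lies in G for imaginary z. A defining function thus vanishes on the
imaginary axis, hence also at z = 1. -/
theorem expGL_I_smul_mem_zariskiClosure {ξ : Mat n} (hξ : ξ ∈ G.lie) :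
    expGL (Complex.I • ξ) ∈ zariskiClosure G := by
  intro f hf hz
  have h := eq_zero_of_forall_I (regular_comp_expGL_mem_expPoly (isHermitian_I_smul G hξ) hf)
    fun t => by
      refine hz _ ?_
      have := hξ (-t)
      rw [smul_smul, mul_assoc, Complex.I_mul_I]
      convert this using 2
      simp [← Complex.coe_smul]
  simpa using congrFun h 1

theorem complexification_le_zariskiClosure : G.complexification ≤ zariskiClosure G := by
  refine Subgroup.topologicalClosure_minimal _ ?_ (isClosed_zariskiClosure G)
  rw [Subgroup.closure_le]
  rintro _ ⟨u, hu, η, hη, rfl⟩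
  exact (zariskiClosure G).mul_mem (expGL_I_smul_mem_zariskiClosure G hη)
    (le_zariskiClosure G hu)

open scoped Matrix.Norms.L2Operator MatrixOrder ComplexOrder in
theorem exists_isHermitian_exp_eq (g : GL (Fin n) ℂ) :
    ∃ A : Mat n, A.IsHermitian ∧ expGL A = g * star g := by
  have hpos : ((g * star g : GL (Fin n) ℂ) : Mat n).PosDef := by
    rw [Units.val_mul, Units.coe_star, Matrix.star_eq_conjTranspose]
    exact Matrix.PosDef.mul_conjTranspose_self _ (Matrix.vecMul_injective_of_isUnit g.isUnit)
  have hsp := Matrix.isStrictlyPositive_iff_posDef.2 hpos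
  refine ⟨CFC.log ((g * star g : GL (Fin n) ℂ) : Mat n), IsSelfAdjoint.log, Units.ext ?_⟩
  rw [coe_expGL]
  exact CFC.exp_log _ hsp

/-- The polar decomposition in the complexification of `G`. -/
theorem exists_polar {g : GL (Fin n) ℂ} (hg : g ∈ G.complexification) :
    ∃ ζ ∈ G.lie, ∃ u ∈ G.grp, g = expGL (Complex.I • ζ) * u := by
  have hz := complexification_le_zariskiClosure G hg
  obtain ⟨A, hA, hexp⟩ := exists_isHermitian_exp_eq g
  have hAz : expGL A ∈ zariskiClosure G := by
    rw [hexp]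
    exact (zariskiClosure G).mul_mem hz (star_mem_zariskiClosure G hz)
  have hzA := expGL_smul_mem_zariskiClosure G hA hAz
  have hstar : star A = A := hA
  have hhalf : expGL (((1 / 2 : ℂ)) • A) * expGL (((1 / 2 : ℂ)) • A) = g * star g := by
    rw [← expGL_add_smul, add_halves, one_smul, hexp]
  have hherm : star (expGL (((1 / 2 : ℂ)) • A)) = expGL (((1 / 2 : ℂ)) • A) := by
    rw [star_expGL, star_smul, hstar]
    simp
  -- The choice makes iζ = A/2, so exp(iζ) is the positive square root of g g* and the other factor
  -- is unitary.
  refine ⟨-((Complex.I / 2) • A), ?_, (expGL (((1 / 2 : ℂ)) • A))⁻¹ * g, ?_, ?_⟩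
  · intro t
    refine mem_of_mem_zariskiClosure G ?_ (expGL_mem_unitaryGroup_of_skew ?_)
    · have : t • -((Complex.I / 2) • A) = (-(t * (Complex.I / 2)) : ℂ) • A := by
        rw [← Complex.coe_smul, smul_neg, smul_smul, neg_smul]
      rw [this]
      exact hzA _
    · rw [star_smul, star_neg, star_smul, hstar]
      simp [neg_div]
  · refine mem_of_mem_zariskiClosure G ((zariskiClosure G).mul_mem
      ((zariskiClosure G).inv_mem (hzA _)) hz) ?_
    have h : (expGL ((1 / 2 : ℂ) • A))⁻¹ * g * star ((expGL ((1 / 2 : ℂ) • A))⁻¹ * g) = 1 := by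
      rw [star_mul, star_inv, hherm, mul_assoc, ← mul_assoc g, ← hhalf]
      group
    rw [Matrix.mem_unitaryGroup_iff, ← Units.coe_star, ← Units.val_mul, h, Units.val_one]
  · have : Complex.I • -((Complex.I / 2) • A) = (1 / 2 : ℂ) • A := by
      rw [smul_neg, smul_smul, ← neg_smul]
      congr 1
      rw [← mul_div_assoc, Complex.I_mul_I]
      norm_num
    rw [this, mul_inv_cancel_left]

end Polar

/-! ### Operator monotonicity of the logarithm -/

section Logarithm

variable {A : Type*} [CStarAlgebra A] [PartialOrder A] [StarOrderedRing A]

theorem exists_pos_smul_one_le {p : A} (hp : IsStrictlyPositive p) :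
    ∃ c : ℝ, 0 < c ∧ c • (1 : A) ≤ p := by
  rcases subsingleton_or_nontrivial A with h | h
  · exact ⟨1, one_pos, (Subsingleton.elim _ _).le⟩
  · obtain ⟨c, hc, hle⟩ := (CFC.exists_pos_algebraMap_le_iff (a := p) hp.isSelfAdjoint).2
      fun x hx => hp.spectrum_pos hx
    exact ⟨c, hc, by rwa [Algebra.algebraMap_eq_smul_one] at hle⟩

theorem isStrictlyPositive_exp {d : A} (hd : IsSelfAdjoint d) :
    IsStrictlyPositive (NormedSpace.exp d) := by
  let _ : NormedAlgebra ℚ A := NormedAlgebra.restrictScalars ℚ ℝ A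
  exact (NormedSpace.isUnit_exp d).isStrictlyPositive hd.exp_nonneg

theorem log_smul_exp {c : ℝ} (hc : 0 < c) {d : A} (hd : IsSelfAdjoint d) :
    CFC.log (c • NormedSpace.exp d) = algebraMap ℝ A (Real.log c) + d := by
  rw [CFC.log_smul' _ hc (isStrictlyPositive_exp hd), CFC.log_exp d hd]

/-- The logarithm of `exp b * p * exp b` differs from `2 b` by a bounded amount. -/
theorem exists_norm_log_sub_le {p : A} (hp : IsStrictlyPositive p) :
    ∃ C : ℝ, ∀ b d : A, IsSelfAdjoint b → IsSelfAdjoint d →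
      NormedSpace.exp d = NormedSpace.exp b * p * NormedSpace.exp b → ‖d - (2 : ℝ) • b‖ ≤ C := by
  let _ : NormedAlgebra ℚ A := NormedAlgebra.restrictScalars ℚ ℝ A
  obtain ⟨c, hc, hcp⟩ := exists_pos_smul_one_le hp
  obtain ⟨c', hc', hcp'⟩ : ∃ c' : ℝ, 0 < c' ∧ p ≤ c' • (1 : A) := by
    refine ⟨‖p‖ + 1, by positivity, ?_⟩
    have h := hp.isSelfAdjoint.le_algebraMap_norm_self
    rw [Algebra.algebraMap_eq_smul_one] at h
    refine h.trans ?_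
    rw [add_smul, one_smul]
    exact le_add_of_nonneg_right zero_le_one
  set l := algebraMap ℝ A (Real.log c)
  set l' := algebraMap ℝ A (Real.log c')
  refine ⟨‖l' - l‖ + ‖l‖, fun b d hb hd h => ?_⟩
  have hexp : IsSelfAdjoint (NormedSpace.exp b) := hb.exp
  have h2b : IsSelfAdjoint ((2 : ℝ) • b) := (IsSelfAdjoint.all (2 : ℝ)).smul hb
  have hsq : ∀ r : ℝ, NormedSpace.exp b * (r • (1 : A)) * NormedSpace.exp b =
      r • NormedSpace.exp ((2 : ℝ) • b) := by
    intro r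
    rw [mul_smul_comm, mul_one, smul_mul_assoc, two_smul,
      NormedSpace.exp_add_of_commute (Commute.refl b)]
  -- Conjugating c ≤ p ≤ c' gives c exp(2b) ≤ exp d ≤ c' exp(2b). Taking logarithms gives log c ≤ d
  -- - 2b ≤ log c', with bounds independent of b and d.
  have h1 := hexp.conjugate_le_conjugate hcp
  have h2 := hexp.conjugate_le_conjugate hcp'
  rw [hsq, ← h] at h1 h2
  have hd' := isStrictlyPositive_exp hd
  have h3 := CFC.log_le_log h1 ((isStrictlyPositive_exp h2b).smul hc)
  have h4 := CFC.log_le_log h2 hd'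
  rw [CFC.log_exp d hd, log_smul_exp hc h2b] at h3
  rw [CFC.log_exp d hd, log_smul_exp hc' h2b] at h4
  have h5 : 0 ≤ d - (2 : ℝ) • b - l := by
    rw [sub_sub, add_comm, sub_nonneg]; exact h3
  have h6 : d - (2 : ℝ) • b - l ≤ l' - l := by
    rw [sub_le_sub_iff_right, sub_le_iff_le_add]; exact h4
  have h7 := CStarAlgebra.norm_le_norm_of_nonneg_of_le h5 h6
  calc ‖d - (2 : ℝ) • b‖ = ‖(d - (2 : ℝ) • b - l) + l‖ := by rw [sub_add_cancel]
    _ ≤ _ := (norm_add_le _ _).trans (by gcongr)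

end Logarithm

/-! ### Curves with zero derivative -/

section Calculus

variable {E : Type*} [NormedAddCommGroup E] [NormedSpace ℂ E]
variable {X : Type*} [TopologicalSpace X] [ChartedSpace E X]

theorem hasMFDerivAt_restrictScalars {c : ℂ → X} {z : ℂ} {D : ℂ →L[ℂ] E}
    (h : HasMFDerivAt 𝓘(ℂ, ℂ) 𝓘(ℂ, E) c z D) :
    HasMFDerivAt 𝓘(ℝ, ℂ) 𝓘(ℝ, E) c z (D.restrictScalars ℝ) :=
  ⟨h.1, HasFDerivWithinAt.restrictScalars ℝ h.2⟩

/-- A curve of zero derivative is constant. -/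
theorem eq_of_hasMFDerivAt_zero [T2Space X] [IsManifold 𝓘(ℂ, E) 1 X] {c : ℂ → X}
    (h : ∀ z, HasMFDerivAt 𝓘(ℂ, ℂ) 𝓘(ℂ, E) c z (0 : ℂ →L[ℂ] E)) (z w : ℂ) : c z = c w := by
  have hcont : Continuous c := continuous_iff_continuousAt.2 fun z => (h z).continuousAt
  -- Inside one chart the curve is locally constant, so this fibre is open; it is closed because X
  -- is Hausdorff, and ℂ is connected.
  have hclopen : IsClopen {z | c z = c w} := by
    refine ⟨isClosed_eq hcont continuous_const, isOpen_iff_mem_nhds.2 fun z₀ hz₀ => ?_⟩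
    have hz₀' : c z₀ = c w := hz₀
    have hU : c ⁻¹' (chartAt E (c w)).source ∈ 𝓝 z₀ := by
      refine hcont.continuousAt.preimage_mem_nhds ?_
      rw [hz₀']
      exact chart_source_mem_nhds E _
    obtain ⟨r, hr, hball⟩ := Metric.mem_nhds_iff.1 hU
    have hderiv : ∀ z ∈ Metric.ball z₀ r,
        HasFDerivAt (fun z => extChartAt 𝓘(ℂ, E) (c w) (c z)) (0 : ℂ →L[ℂ] E) z := by
      intro z hz
      have h1 := (mdifferentiableAt_extChartAt (I := 𝓘(ℂ, E)) (hball hz)).hasMFDerivAt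
      have h2 := h1.comp z (h z)
      let L : E →L[ℂ] E := mfderiv 𝓘(ℂ, E) 𝓘(ℂ, E) (extChartAt 𝓘(ℂ, E) (c w)) (c z)
      have h3 : L.comp (0 : ℂ →L[ℂ] E) = 0 := L.comp_zero
      rw [← h3]
      exact h2.hasFDerivAt
    filter_upwards [Metric.ball_mem_nhds z₀ hr] with z hz
    have hconst : extChartAt 𝓘(ℂ, E) (c w) (c z) = extChartAt 𝓘(ℂ, E) (c w) (c z₀) :=
      Metric.isOpen_ball.is_const_of_fderiv_eq_zero (𝕜 := ℂ)
        (convex_ball z₀ r).isPreconnected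
        (fun z hz => (hderiv z hz).differentiableAt.differentiableWithinAt)
        (fun z hz => (hderiv z hz).fderiv) hz (Metric.mem_ball_self hr)
    have hsrc : ∀ z ∈ Metric.ball z₀ r, c z ∈ (extChartAt 𝓘(ℂ, E) (c w)).source := by
      intro z hz
      rw [extChartAt_source]
      exact hball hz
    exact ((extChartAt 𝓘(ℂ, E) (c w)).injOn (hsrc z hz)
      (hsrc z₀ (Metric.mem_ball_self hr)) hconst).trans hz₀'
  have : z ∈ {z | c z = c w} := by
    rw [hclopen.eq_univ ⟨w, rfl⟩]
    trivial
  exact this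

end Calculus

/-! ### The complex one-parameter orbits z ↦ exp(zη) y -/

section Action

variable {X : Type*} (G : CompactUnitaryGroup n)

/-- Splitting z into real and imaginary parts factors exp(zη) as exp(i Im(z) η) exp(Re(z) η), one of
the generators. -/
theorem expGL_smul_mem_complexification (η : G.lie) (z : ℂ) :
    expGL (z • (η : Mat n)) ∈ G.complexification := by
  have h := G.exp_I_mul_mem (expGL (z.re • (η : Mat n))) (η.2 _) (z.im • (η : Mat n))
    (G.lie.smul_mem _ η.2)
  have h1 : Complex.I • z.im • (η : Mat n) = ((z.im : ℂ) * Complex.I) • (η : Mat n) := by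
    rw [← Complex.coe_smul, smul_smul, mul_comm]
  rwa [h1, ← Complex.coe_smul z.re, ← expGL_add_smul, add_comm, Complex.re_add_im] at h

variable [MulAction G.complexification X]

/-- The curve `z ↦ exp (z η) y`. -/
def orbitCurve (η : G.lie) (y : X) (z : ℂ) : X :=
  (⟨expGL (z • (η : Mat n)), expGL_smul_mem_complexification G η z⟩ : G.complexification) • y

theorem orbitCurve_zero (η : G.lie) (y : X) : orbitCurve G η y 0 = y := by
  have : (⟨expGL ((0 : ℂ) • (η : Mat n)), expGL_smul_mem_complexification G η 0⟩ :
      G.complexification) = 1 := Subtype.ext (by simp [expGL_zero])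
  rw [orbitCurve, this, one_smul]

theorem orbitCurve_add (η : G.lie) (y : X) (z w : ℂ) :
    orbitCurve G η y (z + w) = orbitCurve G η (orbitCurve G η y w) z := by
  rw [orbitCurve, orbitCurve, orbitCurve, smul_smul]
  congr 1
  exact Subtype.ext (expGL_add_smul _ _ _)

end Action

/-! ### Derivatives of the complex orbits -/

section HolomorphicAction

variable {E : Type*} [NormedAddCommGroup E] [NormedSpace ℂ E]
variable {X : Type*} [TopologicalSpace X] [ChartedSpace E X]
variable (G : CompactUnitaryGroup n) [MulAction G.complexification X]

theorem mdifferentiable_smul (h : IsHolomorphicAction E X G.complexification)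
    (g : G.complexification) : MDifferentiable 𝓘(ℂ, E) 𝓘(ℂ, E) fun y : X => g • y := by
  intro y
  have h1 : MDifferentiableAt 𝓘(ℂ, E) (𝓘(ℂ, Fin n → Fin n → ℂ).prod 𝓘(ℂ, E))
      (fun y : X => (entries (g : GL (Fin n) ℂ), y)) y :=
    mdifferentiableAt_const.prodMk mdifferentiableAt_id
  have h2 := (h.mdifferentiableOn (by simp)) (entries (g : GL (Fin n) ℂ), y) ⟨g, g.2, rfl⟩
  have h3 := h2.comp y h1.mdifferentiableWithinAt (s := univ) fun y _ => ⟨g, g.2, rfl⟩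
  rw [mdifferentiableWithinAt_univ] at h3
  refine h3.congr_of_eventuallyEq (Eventually.of_forall fun y => ?_)
  exact (actionMap_entries _ g y).symm

open scoped Matrix.Norms.Operator in
theorem differentiable_entries_expGL (A : Mat n) :
    Differentiable ℂ fun z : ℂ => entries (expGL (z • A)) := by
  intro z
  have h := (hasDerivAt_exp_smul_const (𝕂 := ℂ) A z).differentiableAt
  rw [differentiableAt_pi]
  intro i
  rw [differentiableAt_pi]
  intro j
  exact ((Matrix.entryLinearMap ℂ ℂ i j).toContinuousLinearMap.differentiableAt).comp z h

theorem mdifferentiable_orbitCurve (h : IsHolomorphicAction E X G.complexification) (η : G.lie)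
    (y : X) : MDifferentiable 𝓘(ℂ, ℂ) 𝓘(ℂ, E) (orbitCurve G η y) := by
  intro z
  have h1 : MDifferentiableAt 𝓘(ℂ, ℂ) (𝓘(ℂ, Fin n → Fin n → ℂ).prod 𝓘(ℂ, E))
      (fun z : ℂ => (entries (expGL (z • (η : Mat n))), y)) z :=
    (differentiable_entries_expGL (η : Mat n) z).mdifferentiableAt.prodMk mdifferentiableAt_const
  have hmem : ∀ z : ℂ, (entries (expGL (z • (η : Mat n))), y) ∈ groupTimes G.complexification X :=
    fun z => ⟨_, expGL_smul_mem_complexification G η z, rfl⟩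
  have h2 := (h.mdifferentiableOn (by simp)) _ (hmem z)
  have hsub : univ ⊆ (fun z : ℂ => (entries (expGL (z • (η : Mat n))), y)) ⁻¹'
      groupTimes G.complexification X := fun z _ => hmem z
  have h3 := h2.comp z h1.mdifferentiableWithinAt hsub
  rw [mdifferentiableWithinAt_univ] at h3
  refine h3.congr_of_eventuallyEq (Eventually.of_forall fun z => ?_)
  exact (actionMap_entries _ (⟨_, expGL_smul_mem_complexification G η z⟩ : G.complexification)
    y).symm

variable [MulAction G.grp X]

variable (E) in
/-- The infinitesimal action, as a vector of the model space `E`. -/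
def infVector (η : G.lie) (y : X) : E := infAction E G η y

/-- On the real axis the complex orbit is the orbit under G, so the infinitesimal action is the
complex derivative applied to 1. -/
theorem infVector_eq_of_hasMFDerivAt (h : IsComplexifiedAction (X := X) E G) (η : G.lie) (y : X)
    {D : ℂ →L[ℂ] E} (hD : HasMFDerivAt 𝓘(ℂ, ℂ) 𝓘(ℂ, E) (orbitCurve G η y) 0 D) :
    infVector E G η y = D 1 := by
  have h0 : HasMFDerivAt 𝓘(ℝ, ℂ) 𝓘(ℝ, E) (orbitCurve G η y) (Complex.ofRealCLM (0 : ℝ))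
      (D.restrictScalars ℝ) := by
    rw [Complex.ofRealCLM_apply, Complex.ofReal_zero]
    exact hasMFDerivAt_restrictScalars hD
  have h1 := h0.comp (0 : ℝ) Complex.ofRealCLM.hasMFDerivAt
  have h2 : (fun t : ℝ => (⟨expGL (t • (η : Mat n)), η.2 t⟩ : G.grp) • y) =
      orbitCurve G η y ∘ Complex.ofRealCLM := by
    ext t
    rw [← h.extends_action]
    rfl
  rw [infVector, infAction, h2, h1.mfderiv]
  change D ((1 : ℝ) : ℂ) = D 1
  simp

/-- The curve `z ↦ exp (z η) y` has the derivative `w ↦ w v_η`. -/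
theorem hasMFDerivAt_orbitCurve (h : IsComplexifiedAction (X := X) E G) (η : G.lie) (y : X)
    (z : ℂ) : HasMFDerivAt 𝓘(ℂ, ℂ) 𝓘(ℂ, E) (orbitCurve G η y) z
      (ContinuousLinearMap.toSpanSingleton ℂ (infVector E G η (orbitCurve G η y z)) : ℂ →L[ℂ] E) := by
  set y' := orbitCurve G η y z
  obtain ⟨D, hD⟩ : ∃ D : ℂ →L[ℂ] E, HasMFDerivAt 𝓘(ℂ, ℂ) 𝓘(ℂ, E) (orbitCurve G η y') 0 D :=
    ⟨_, (mdifferentiable_orbitCurve G h.holomorphic η y' 0).hasMFDerivAt⟩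
  have hv := infVector_eq_of_hasMFDerivAt G h η y' hD
  have hDv : D = ContinuousLinearMap.toSpanSingleton ℂ (infVector E G η y') := by
    rw [hv]
    ext
    simp
  rw [← hDv]
  have h0 : ∀ w : ℂ, w = 0 → HasMFDerivAt 𝓘(ℂ, ℂ) 𝓘(ℂ, E) (orbitCurve G η y') w D := by
    rintro _ rfl
    exact hD
  have h1 : HasMFDerivAt 𝓘(ℂ, ℂ) 𝓘(ℂ, ℂ) (fun w : ℂ => w - z) z (ContinuousLinearMap.id ℂ ℂ) :=
    ((hasFDerivAt_id z).sub_const z).hasMFDerivAt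
  have h2 := HasMFDerivAt.comp z (f := fun w : ℂ => w - z) (h0 (z - z) (sub_self z)) h1
  -- The group law moves the base point to y', so the derivative at 0 determines the derivative at
  -- every z.
  have h3 : orbitCurve G η y = orbitCurve G η y' ∘ fun w : ℂ => w - z := by
    ext w
    rw [Function.comp_apply, ← orbitCurve_add, sub_add_cancel]
  rw [h3]
  exact h2

/-- A point at which `v_η` vanishes is fixed by `exp (z η)`. -/
theorem orbitCurve_eq_of_infVector_eq_zero [T2Space X] [IsManifold 𝓘(ℂ, E) 1 X]
    (h : IsComplexifiedAction (X := X) E G) {η : G.lie} {y : X} (hη : infVector E G η y = 0)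
    (z : ℂ) : orbitCurve G η y z = y := by
  refine (eq_of_hasMFDerivAt_zero (E := E) (fun z => ?_) z 0).trans (orbitCurve_zero G η y)
  have hy := orbitCurve_zero G η y
  have h0 : ∀ w : ℂ, w = 0 →
      HasMFDerivAt 𝓘(ℂ, ℂ) 𝓘(ℂ, E) (orbitCurve G η y) w (0 : ℂ →L[ℂ] E) := by
    rintro _ rfl
    have h1 := hasMFDerivAt_orbitCurve G h η y 0
    have h2 : infVector E G η (orbitCurve G η y 0) = 0 := by
      rw [hy]
      exact hη
    rw [h2, ContinuousLinearMap.toSpanSingleton_zero] at h1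
    exact h1
  let g : G.complexification := ⟨_, expGL_smul_mem_complexification G η z⟩
  have h1 : HasMFDerivAt 𝓘(ℂ, ℂ) 𝓘(ℂ, ℂ) (fun w : ℂ => w - z) z (ContinuousLinearMap.id ℂ ℂ) :=
    ((hasFDerivAt_id z).sub_const z).hasMFDerivAt
  have h2 := HasMFDerivAt.comp z (f := fun w : ℂ => w - z) (h0 (z - z) (sub_self z)) h1
  have h3 := (mdifferentiable_smul G h.holomorphic g
    ((orbitCurve G η y ∘ fun w : ℂ => w - z) z)).hasMFDerivAt.comp z h2
  -- Translation by exp(zη) carries the zero derivative at 0 to the derivative at z.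
  have h4 : orbitCurve G η y =
      (fun y : X => g • y) ∘ (orbitCurve G η y ∘ fun w : ℂ => w - z) := by
    ext w
    change _ = orbitCurve G η (orbitCurve G η y (w - z)) z
    rw [← orbitCurve_add, add_sub_cancel]
  rw [← h4] at h3
  refine h3.congr_mfderiv ?_
  let L : E →L[ℂ] E := mfderiv 𝓘(ℂ, E) 𝓘(ℂ, E) (fun y : X => g • y)
    ((orbitCurve G η y ∘ fun w : ℂ => w - z) z)
  ext
  exact L.map_zero

end HolomorphicAction

/-! ### Norm estimates on the Lie algebra -/

section InnerProduct

variable {G : CompactUnitaryGroup n} (B : InvariantInner G)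

/-- The Lie algebra with an invariant inner product is isometric to a Euclidean space. -/
theorem InvariantInner.exists_isometry : ∃ (N : ℕ) (T : G.lie ≃ₗ[ℝ] EuclideanSpace ℝ (Fin N)),
    ∀ ξ η, B.ip ξ η = inner ℝ (T ξ) (T η) := by
  let _ : NormedAddCommGroup G.lie := B.core.toNormedAddCommGroup
  let _ : InnerProductSpace ℝ G.lie := InnerProductSpace.ofCore B.core.toCore
  let b := stdOrthonormalBasis ℝ G.lie
  exact ⟨_, b.repr.toLinearEquiv, fun ξ η => (b.repr.inner_map_map ξ η).symm⟩

theorem InvariantInner.norm_eq {N : ℕ} {T : G.lie ≃ₗ[ℝ] EuclideanSpace ℝ (Fin N)}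
    (hT : ∀ ξ η, B.ip ξ η = inner ℝ (T ξ) (T η)) (ξ : G.lie) : B.norm ξ = ‖T ξ‖ := by
  rw [InvariantInner.norm, hT, real_inner_self_eq_norm_sq, Real.sqrt_sq (norm_nonneg _)]

theorem InvariantInner.norm_nonneg (ξ : G.lie) : 0 ≤ B.norm ξ := Real.sqrt_nonneg _

theorem InvariantInner.norm_sq (ξ : G.lie) : B.norm ξ ^ 2 = B.ip ξ ξ := by
  obtain ⟨N, T, hT⟩ := B.exists_isometry
  rw [B.norm_eq hT, hT, real_inner_self_eq_norm_sq]

theorem InvariantInner.abs_ip_le (ξ η : G.lie) : |B.ip ξ η| ≤ B.norm ξ * B.norm η := by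
  obtain ⟨N, T, hT⟩ := B.exists_isometry
  rw [B.norm_eq hT, B.norm_eq hT, hT]
  exact abs_real_inner_le_norm _ _

theorem InvariantInner.norm_sub_smul_le (ξ η : G.lie) {t : ℝ} (ht : 0 ≤ t) :
    B.norm (η - t • ξ) ≤ B.norm η + t * B.norm ξ := by
  obtain ⟨N, T, hT⟩ := B.exists_isometry
  rw [B.norm_eq hT, B.norm_eq hT, B.norm_eq hT, map_sub, map_smul]
  refine (norm_sub_le _ _).trans ?_
  rw [norm_smul, Real.norm_of_nonneg ht]

theorem InvariantInner.ip_sub_smul (ξ η : G.lie) (t : ℝ) :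
    B.ip ξ (η - t • ξ) = B.ip ξ η - t * B.norm ξ ^ 2 := by
  obtain ⟨N, T, hT⟩ := B.exists_isometry
  rw [B.norm_sq, hT, hT, hT, map_sub, map_smul, inner_sub_right, inner_smul_right]

theorem InvariantInner.norm_Ad (u : G.grp) (ξ : G.lie) : B.norm (G.Ad u ξ) = B.norm ξ := by
  rw [InvariantInner.norm, InvariantInner.norm]
  congr 1
  exact B.invariant u ξ ξ

open scoped Matrix.Norms.L2Operator in
theorem InvariantInner.exists_norm_le :
    ∃ M : ℝ, 0 ≤ M ∧ ∀ ξ : G.lie, B.norm ξ ≤ M * ‖(ξ : Mat n)‖ := by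
  obtain ⟨N, T, hT⟩ := B.exists_isometry
  let T' : G.lie →L[ℝ] EuclideanSpace ℝ (Fin N) := LinearMap.toContinuousLinearMap T.toLinearMap
  refine ⟨‖T'‖, T'.opNorm_nonneg, fun ξ => ?_⟩
  rw [B.norm_eq hT]
  exact T'.le_opNorm ξ

end InnerProduct

/-! ### Critical points and monotonicity of the moment map -/

section MomentMap

variable {E : Type*} [NormedAddCommGroup E] [NormedSpace ℂ E]
variable {X : Type*} [TopologicalSpace X] [ChartedSpace E X]
variable {G : CompactUnitaryGroup n} [MulAction G.grp X]
variable {K : KahlerStructure E X} {B : InvariantInner G} {μ : X → G.lie}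

theorem KahlerStructure.form_J_nonneg (K : KahlerStructure E X) (x : X) (v : RT E x) :
    0 ≤ K.form x ![v, J x v] := by
  by_cases hv : v = 0
  · exact ((K.form x).map_coord_zero (m := ![v, J x v]) 0 hv).ge
  · exact (K.metric_pos x v hv).le

/-- The differential of `H_ξ = ⟨μ, ξ⟩` as a linear form on the model space. -/
theorem IsMomentMap.exists_hasMFDerivAt (hμ : IsMomentMap K G B μ) (ξ : G.lie) (x : X) :
    ∃ L : E →L[ℝ] ℝ, HasMFDerivAt 𝓘(ℝ, E) 𝓘(ℝ, ℝ) (fun y => B.ip (μ y) ξ) x L ∧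
      ∀ v : RT E x, L v = K.form x ![infAction E G ξ x, v] :=
  ⟨_, ((hμ.smooth ξ).mdifferentiable (by simp) x).hasMFDerivAt, fun v => hμ.hamiltonian ξ x v⟩

/-- In orthonormal coordinates both differentials are Σ aᵢ(x) daᵢ. Coordinates are used because
smoothness of μ is given through its pairings with fixed vectors. -/
theorem hasMFDerivAt_half_norm_sq (hμ : IsMomentMap K G B μ) {x : X} {L : E →L[ℝ] ℝ}
    (hL : HasMFDerivAt 𝓘(ℝ, E) 𝓘(ℝ, ℝ) (fun y => B.ip (μ y) (μ x)) x L) :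
    HasMFDerivAt 𝓘(ℝ, E) 𝓘(ℝ, ℝ) (fun y => (1 / 2 : ℝ) * B.norm (μ y) ^ 2) x L := by
  obtain ⟨N, T, hT⟩ := B.exists_isometry
  let a : Fin N → X → ℝ := fun i y => B.ip (μ y) (T.symm (EuclideanSpace.single i 1))
  have ha : ∀ i y, a i y = T (μ y) i := by
    intro i y
    simp only [a]
    rw [hT, LinearEquiv.apply_symm_apply, EuclideanSpace.inner_single_right]
    simp
  have hip : ∀ y y', B.ip (μ y) (μ y') = ∑ i, a i y' * a i y := by
    intro y y'
    rw [hT, PiLp.inner_apply]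
    simp [ha]
  choose a' ha' _ using fun i => hμ.exists_hasMFDerivAt (T.symm (EuclideanSpace.single i 1)) x
  have h1 : HasMFDerivAt 𝓘(ℝ, E) 𝓘(ℝ, ℝ) (∑ i, a i x • a i) x (∑ i, a i x • a' i : E →L[ℝ] ℝ) :=
    HasMFDerivAt.sum fun i _ => (ha' i).const_smul (a i x)
  have h2 : HasMFDerivAt 𝓘(ℝ, E) 𝓘(ℝ, ℝ) (∑ i, a i * a i) x
      (∑ i, (a i x • a' i + a i x • a' i) : E →L[ℝ] ℝ) :=
    HasMFDerivAt.sum fun i _ => (ha' i).mul (ha' i)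
  have h3 := h2.const_smul (1 / 2 : ℝ)
  have e1 : (∑ i, a i x • a i) = fun y => B.ip (μ y) (μ x) := by
    ext y
    simp [hip]
  have e3 : ((1 / 2 : ℝ) • ∑ i, a i * a i) = fun y => (1 / 2 : ℝ) * B.norm (μ y) ^ 2 := by
    ext y
    simp [B.norm_sq, hip]
  rw [e1] at h1
  rw [e3] at h3
  have e : L = ((1 / 2 : ℝ) • ∑ i, (a i x • a' i + a i x • a' i) : E →L[ℝ] ℝ) := by
    have : L = (∑ i, a i x • a' i : E →L[ℝ] ℝ) := hasMFDerivAt_unique hL h1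
    rw [this, Finset.sum_add_distrib, ← two_smul ℝ, smul_smul]
    norm_num
  rw [e]
  exact h3

/-- At a critical point of the moment map squared the vector field of `μ(x)` vanishes. -/
theorem infVector_eq_zero_of_isCriticalPoint (hμ : IsMomentMap K G B μ) {x : X}
    (hx : IsCriticalPoint E B μ x) : infVector E G (μ x) x = 0 := by
  obtain ⟨L, hL, hform⟩ := hμ.exists_hasMFDerivAt (μ x) x
  have h1 := (hasMFDerivAt_half_norm_sq hμ hL).mfderiv
  have h2 : L = 0 := h1.symm.trans hx
  by_contra hv
  -- The vanishing form ω(v, ·) would be positive on Jv if v were nonzero.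
  have h3 := K.metric_pos x (infAction E G (μ x) x) hv
  rw [← hform, h2] at h3
  exact lt_irrefl _ h3

variable [MulAction G.complexification X]

/-- The function `t ↦ ⟨μ(exp (i t η) y), η⟩` is nondecreasing. -/
theorem ip_le_ip_orbitCurve_I (hμ : IsMomentMap K G B μ)
    (hGc : IsComplexifiedAction (X := X) E G) (η : G.lie) (y : X) :
    B.ip (μ y) η ≤ B.ip (μ (orbitCurve G η y Complex.I)) η := by
  let ℓ : ℝ →L[ℝ] ℂ := ContinuousLinearMap.toSpanSingleton ℝ Complex.I
  let φ : ℝ → ℝ := fun t => B.ip (μ (orbitCurve G η y (ℓ t))) η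
  have hφ : ∀ t, ∃ d, HasDerivAt φ d t ∧ 0 ≤ d := by
    intro t
    obtain ⟨L, hL, hform⟩ := hμ.exists_hasMFDerivAt η (orbitCurve G η y (ℓ t))
    have h1 := hasMFDerivAt_restrictScalars (hasMFDerivAt_orbitCurve G hGc η y (ℓ t))
    have h2 := hL.comp t (h1.comp t ℓ.hasMFDerivAt)
    let D : ℂ →L[ℂ] E :=
      ContinuousLinearMap.toSpanSingleton ℂ (infVector E G η (orbitCurve G η y (ℓ t)))
    have h4 : HasFDerivAt φ (L.comp ((D.restrictScalars ℝ).comp ℓ)) t := h2.hasFDerivAt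
    refine ⟨_, h4.hasDerivAt, ?_⟩
    -- The velocity along the imaginary direction is J v_η, so the derivative is ω(v_η, J v_η), the
    -- squared length of v_η.
    have h3 := K.form_J_nonneg _ (infAction E G η (orbitCurve G η y (ℓ t)))
    rw [← hform] at h3
    refine h3.trans_eq ?_
    change L (Complex.I • infVector E G η (orbitCurve G η y (ℓ t))) =
      L (((1 : ℝ) • Complex.I) • infVector E G η (orbitCurve G η y (ℓ t)))
    rw [one_smul]
  choose d hd hd0 using hφ
  have hmono : Monotone φ := monotone_of_hasDerivAt_nonneg hd hd0
  have h := hmono zero_le_one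
  simpa [φ, ℓ, orbitCurve_zero] using h

end MomentMap

/-! ### Asymptotics of the polar part and the inequality -/

variable {E : Type*} [NormedAddCommGroup E] [NormedSpace ℂ E]
variable {X : Type*} [TopologicalSpace X] [ChartedSpace E X]
variable {G : CompactUnitaryGroup n}

open scoped Matrix.Norms.L2Operator MatrixOrder ComplexOrder in
/-- In the polar decomposition of `exp (-i t ξ) h`, the Hermitian part is `-t ξ` up to a bounded
error. -/
theorem exists_norm_polar_add_smul_le (B : InvariantInner G) (ξ : G.lie) (h : GL (Fin n) ℂ) :
    ∃ R : ℝ, ∀ (t : ℝ) (ζ : G.lie) (u : GL (Fin n) ℂ), u ∈ G.grp →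
      expGL ((-(t * Complex.I)) • (ξ : Mat n)) * h = expGL (Complex.I • (ζ : Mat n)) * u →
      B.norm (ζ + t • ξ) ≤ R := by
  have hp : IsStrictlyPositive ((h * star h : GL (Fin n) ℂ) : Mat n) := by
    rw [Matrix.isStrictlyPositive_iff_posDef, Units.val_mul, Units.coe_star,
      Matrix.star_eq_conjTranspose]
    exact Matrix.PosDef.mul_conjTranspose_self _ (Matrix.vecMul_injective_of_isUnit h.isUnit)
  obtain ⟨C, hC⟩ := exists_norm_log_sub_le hp
  obtain ⟨M, hM0, hM⟩ := B.exists_norm_le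
  -- C bounds the operator norm of 2i(ζ + tξ), which explains the half; M compares the invariant
  -- norm with the operator norm.
  refine ⟨M * (C / 2), fun t ζ u hu hpolar => (hM _).trans ?_⟩
  gcongr
  have hherm : ∀ η : G.lie, star (Complex.I • (η : Mat n)) = Complex.I • (η : Mat n) :=
    fun η => isHermitian_I_smul G η.2
  have hb : (-(t * Complex.I)) • (ξ : Mat n) = Complex.I • ((-(t • ξ) : G.lie) : Mat n) := by
    push_cast
    rw [← Complex.coe_smul, smul_neg, smul_smul, neg_smul, mul_comm]
  have hd : IsSelfAdjoint ((2 : ℝ) • Complex.I • (ζ : Mat n)) :=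
    (IsSelfAdjoint.all (2 : ℝ)).smul (hherm ζ)
  -- Multiplying each side of the polar identity by its adjoint eliminates u.
  have hexp : expGL ((2 : ℝ) • Complex.I • (ζ : Mat n)) =
      expGL (Complex.I • ((-(t • ξ) : G.lie) : Mat n)) * (h * star h) *
        expGL (Complex.I • ((-(t • ξ) : G.lie) : Mat n)) := by
    have h1 := congrArg (fun k => k * star k) hpolar
    simp only [star_mul, star_expGL, hb, hherm] at h1
    have hu' : u * star u = 1 := by
      rw [star_eq_inv_of_mem (G.unitary u hu), mul_inv_cancel]
    calc _ = expGL (Complex.I • (ζ : Mat n)) * u * (star u * expGL (Complex.I • (ζ : Mat n))) := by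
          rw [two_smul, expGL_add_of_commute (Commute.refl _), mul_assoc _ u, ← mul_assoc u, hu',
            one_mul]
      _ = _ := by rw [← h1]; simp only [mul_assoc]
  have h2 := hC _ _ (hherm (-(t • ξ))) hd (by
    have := congrArg Units.val hexp
    simpa only [Units.val_mul, coe_expGL] using this)
  have h3 : (2 : ℝ) • Complex.I • (ζ : Mat n) - (2 : ℝ) • Complex.I • ((-(t • ξ) : G.lie) : Mat n) =
      (2 * Complex.I) • ((ζ + t • ξ : G.lie) : Mat n) := by
    rw [← smul_sub, ← smul_sub, ← Complex.coe_smul, smul_smul]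
    push_cast
    rw [sub_neg_eq_add]
  rw [h3, norm_smul, norm_mul, Complex.norm_I, mul_one, Complex.norm_two] at h2
  linarith

variable [MulAction G.grp X] [MulAction G.complexification X]
variable {K : KahlerStructure E X} {B : InvariantInner G} {μ : X → G.lie}

/-- Monotonicity of the moment map along the geodesic from `y` to a point `x = k y`. -/
theorem exists_neg_norm_mul_le_ip (hμ : IsMomentMap K G B μ)
    (hGc : IsComplexifiedAction (X := X) E G) (k : G.complexification) (y : X) :
    ∃ ζ : G.lie, ∃ u ∈ G.grp, (k : GL (Fin n) ℂ) = expGL (Complex.I • (ζ : Mat n)) * u ∧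
      -(B.norm (μ y) * B.norm ζ) ≤ B.ip (μ (k • y)) ζ := by
  obtain ⟨ζ, hζ, u, hu, hpolar⟩ := exists_polar G k.2
  refine ⟨⟨ζ, hζ⟩, u, hu, hpolar, ?_⟩
  let v : G.grp := ⟨u, hu⟩
  -- This turns exp(iζ) u into u exp(iη): up to an element of G, ky is the endpoint of the imaginary
  -- orbit of η through y.
  let η : G.lie := G.Ad v⁻¹ ⟨ζ, hζ⟩
  have hη : Complex.I • (η : Mat n) =
      ((u⁻¹ : GL (Fin n) ℂ) : Mat n) * (Complex.I • ζ) * ((u⁻¹⁻¹ : GL (Fin n) ℂ) : Mat n) := by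
    rw [mul_smul_comm, smul_mul_assoc]
    rfl
  have hk : k = ⟨u, G.le_complexification hu⟩ *
      ⟨expGL (Complex.I • (η : Mat n)), expGL_smul_mem_complexification G η Complex.I⟩ := by
    have h : (k : GL (Fin n) ℂ) = u * expGL (Complex.I • (η : Mat n)) := by
      rw [hη, ← units_conj_expGL, hpolar]
      group
    exact Subtype.ext h
  have hky : k • y = v • orbitCurve G η y Complex.I := by
    rw [← hGc.extends_action, orbitCurve, smul_smul, ← hk]
  have h1 : orbitCurve G η y Complex.I = v⁻¹ • k • y := by
    rw [hky, inv_smul_smul]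
  have h2 := ip_le_ip_orbitCurve_I hμ hGc η y
  have h3 : B.ip (μ (orbitCurve G η y Complex.I)) η = B.ip (μ (k • y)) ⟨ζ, hζ⟩ := by
    rw [h1, hμ.equivariant]
    exact B.invariant _ _ _
  have h4 := neg_le_of_abs_le (B.abs_ip_le (μ y) η)
  have h5 : B.norm η = B.norm ⟨ζ, hζ⟩ := B.norm_Ad _ _
  rw [h5] at h4
  exact h4.trans (h2.trans_eq h3)

/-- A real number `m ≥ 0` that satisfies `t a² - a R ≤ m (R + t a)` for all `t ≥ 0` is at
least `a`. -/
theorem le_of_forall_mul_sq_sub_le {a m R : ℝ} (hm : 0 ≤ m)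
    (h : ∀ t : ℝ, 0 ≤ t → t * a ^ 2 - a * R ≤ m * (R + t * a)) : a ≤ m := by
  by_contra! hlt
  have hpos : 0 < a * (a - m) := mul_pos (hm.trans_lt hlt) (sub_pos.2 hlt)
  -- The hypothesis rearranges to t a (a - m) ≤ R (m + a); this t makes the left side |R (m + a)| +
  -- 1.
  have h1 := h ((|R * (m + a)| + 1) / (a * (a - m))) (by positivity)
  have h2 : (|R * (m + a)| + 1) / (a * (a - m)) * (a * (a - m)) = |R * (m + a)| + 1 :=
    div_mul_cancel₀ _ hpos.ne'
  have h3 := le_abs_self (R * (m + a))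
  nlinarith

/-- If `v_ξ` vanishes at `x`, for `ξ = μ(x)`, then `x` minimizes the norm of the moment map on its
orbit under the complexified group. -/
theorem norm_le_norm_smul_of_infVector_eq_zero [T2Space X] [IsManifold 𝓘(ℂ, E) 1 X]
    (hμ : IsMomentMap K G B μ) (hGc : IsComplexifiedAction (X := X) E G) {x : X}
    (hx : infVector E G (μ x) x = 0) (g : G.complexification) :
    B.norm (μ x) ≤ B.norm (μ (g • x)) := by
  obtain ⟨R, hR⟩ := exists_norm_polar_add_smul_le B (μ x) ((g : GL (Fin n) ℂ)⁻¹)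
  refine le_of_forall_mul_sq_sub_le (R := R) (B.norm_nonneg _) fun t ht => ?_
  -- This exp(-itξ) fixes x, so t is a free parameter in the element that carries gx back to x.
  let e : G.complexification :=
    ⟨_, expGL_smul_mem_complexification G (μ x) (-(t * Complex.I))⟩
  obtain ⟨ζ, u, hu, hpolar, hle⟩ := exists_neg_norm_mul_le_ip hμ hGc (e * g⁻¹) (g • x)
  have hfix : (e * g⁻¹) • g • x = x := by
    rw [mul_smul, inv_smul_smul]
    exact orbitCurve_eq_of_infVector_eq_zero G hGc hx _
  rw [hfix] at hle
  have hRt := hR t ζ u hu hpolar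
  have hζ : ζ = (ζ + t • μ x) - t • μ x := by rw [add_sub_cancel_right]
  have h1 : B.norm ζ ≤ R + t * B.norm (μ x) := by
    rw [hζ]
    exact (B.norm_sub_smul_le _ _ ht).trans (by gcongr)
  -- The main term of ζ is -tξ, so the pairing is -t|ξ|² up to an error bounded by |ξ| R.
  have h2 : B.ip (μ x) ζ ≤ B.norm (μ x) * R - t * B.norm (μ x) ^ 2 := by
    rw [hζ, B.ip_sub_smul]
    gcongr
    refine (le_abs_self _).trans ((B.abs_ip_le _ _).trans ?_)
    gcongr
    exact B.norm_nonneg _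
  have h3 := mul_le_mul_of_nonneg_left h1 (B.norm_nonneg (μ (g • x)))
  linarith

end KirwanNess

end

theorem corollary6p2
    {E : Type*} [NormedAddCommGroup E] [NormedSpace ℂ E] [FiniteDimensional ℂ E]
    {X : Type*} [TopologicalSpace X] [T2Space X] [CompactSpace X] [ChartedSpace E X]
    [IsManifold 𝓘(ℂ, E) ω X]
    (K : KirwanNess.KahlerStructure E X)
    {n : ℕ} (G : KirwanNess.CompactUnitaryGroup n)
    [MulAction G.grp X] (hG : KirwanNess.IsKahlerAction K G)
    (B : KirwanNess.InvariantInner G)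
    (μ : X → G.lie) (hμ : KirwanNess.IsMomentMap K G B μ)
    [MulAction G.complexification X] (hGc : KirwanNess.IsComplexifiedAction (X := X) E G)
    (x : X) (hx : KirwanNess.IsCriticalPoint E B μ x) :
    ∀ g : G.complexification, B.norm (μ x) ≤ B.norm (μ (g • x)) := by
  have : IsManifold 𝓘(ℂ, E) 1 X := IsManifold.of_le (n := ω) le_top
  exact KirwanNess.norm_le_norm_smul_of_infVector_eq_zero hμ hGc
    (KirwanNess.infVector_eq_zero_of_isCriticalPoint hμ hx)
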